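/- Let $\pi:\Phi\to M$ be a smooth fibre bundle (or any smooth submersion) over an $n$-dimensional manifold, $n\ge 1$, with $N$-dimensional fibres, let $k\ge 1$, and let $\mathcal L$ be a smooth Lagrangian density of order $k$, i.e. a smooth fibre-preserving map $J^k\Phi\to\Lambda^nT^*M$. Fix a fibred chart $(x^\lambda,\varphi^K)$ of $\Phi$; the phase bundles below are described over its domain, all statements being local and holding for every fibred chart. For multi-indices $\mu$ let $\varphi^K_\mu$ be the jet coordinates, and write $\mathcal L=L\,d^nx$. $\partial_\lambda$ denotes the derivative with respect to $x^\lambda$ along sections, and repeated indices $\lambda$ are summed. *Infinitesimal phase bundle.* Let $\mathcal P=V^*(J^{k-1}\Phi)\otimes\Lambda^{n-1}T^*M$, with fibre coordinates $\varphi^K_\mu,\ p^{\mu\lambda}_K$ ($|\mu|\le k-1$), and let $\widetilde{\mathcal P}^I$ be the part of $J^1\mathcal P$ lying over the holonomic jets $J^k\Phi\subset J^1(J^{k-1}\Phi)$. On each fibre $\widetilde{\mathcal P}^I_x$ let $$\widetilde\theta^I=\sum_{|\mu|\le k-1}\big(p^{\mu\lambda}_K\,\delta\varphi^K_{\mu+e_\lambda}+p^{\mu\lambda}_{K,\lambda}\,\delta\varphi^K_\mu\big)\otimes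 d^nx,\qquad \widetilde\omega^I=\delta\widetilde\theta^I .$$ $\mathcal P^I_x$ is the space of leaves of the degeneracy distribution of $\widetilde\omega^I$. It has the coordinates $\varphi^K_\mu,\ j^\mu_K$ ($|\mu|\le k$), where $$j^\mu_K=p^{(\mu)}_K+p^{\mu\lambda}_{K,\lambda},\qquad p^{(\mu)}_K:=\sum_{\nu+e_\lambda=\mu}p^{\nu\lambda}_K ,$$ the second term of $j^\mu_K$ being absent for $|\mu|=k$ and the first one vanishing for $\mu=0$. The reduced forms are $\theta^I=\sum j^\mu_K\,\delta\varphi^K_\mu\otimes d^nx$ and $\omega^I=\delta\theta^I$; through $\theta^I$ the points of $\mathcal P^I_x$ are $\Lambda^nT_x^*M$-valued covectors on $J^k_x\Phi$. *Claim.* 1. For every $x$, the graph $\mathcal D_x\subset\mathcal P^I_x$ of $\delta\mathcal L_x$ is the image of a smooth section of $\mathcal P^I_x\to J^k_x\Phi$; it is the only image of a smooth section which satisfies the generating formula $\delta\mathcal L=\theta^I|_{\mathcal D}$; and it is an embedded Lagrangian submanifold for $\omega^I$. 2. A smooth local section $\sigma=(\varphi_\mu,p^{\mu\lambda})$ of $\mathcal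 P$ over an open set $O\subset M$ (with values in the domain of the chart) satisfies the first-order equation $\mathcal D$ on $O$ (i.e. at each $x\in O$ its first jet is holonomic and the class of this jet in $\mathcal P^I_x$ lies in $\mathcal D_x$) if and only if its underlying section of $J^{k-1}\Phi$ is $j^{k-1}s$ for a smooth section $s$ of $\Phi$ over $O$ and, along $j^ks$, $$p^{(\mu)}_K=\frac{\partial L}{\partial\varphi^K_\mu}-\partial_\lambda p^{\mu\lambda}_K\qquad(0\le|\mu|\le k),$$ with no last term for $|\mu|=k$ and with $p^{(0)}=0$. Equivalently: if and only if it lies over $j^{k-1}s$, these equations hold for $1\le|\mu|\le k$ (recursive definition of the momenta), and $s$ satisfies the Euler–Lagrange equations $$\sum_{|\mu|\le k}(-1)^{|\mu|}\,\partial_\mu\!\left(\frac{\partial L}{\partial\varphi^K_\mu}\circ j^ks\right)=0\qquad(K=1,\dots,N).$$ 3. A smooth section $s$ of $\Phi$ over an open set $O$, with values in the domain of the chart, satisfies the Euler–Lagrange equations on $O$ if and only if there is a smooth section of $\mathcal P$ over $O$ (in the chart) which lies over $j^{k-1}s$ and satisfies $\mathcal D$. In this case there is exactly one such section whose momenta are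 totally symmetric in the chart, i.e. for which $\nu!\,p^{\nu\lambda}_K$ depends on $\nu+e_\lambda$ and $K$ only. -/

import Mathlib

open scoped Manifold ContDiff Topology

noncomputable section

namespace HOVar

/-! ### Multi-indices, jet coordinates, momenta

Throughout, the Lagrangian has order `k + 1` (`k : ℕ`), so that the configuration bundle of the
theory is the bundle of `k`-th jets and the infinitesimal configuration bundle is the bundle of
`(k + 1)`-st jets. -/

/-- Multi-indices in `n` variables of length at most `l`. -/
abbrev MIdx (n l : ℕ) : Type := {μ : Fin n → ℕ // ∑ i, μ i ≤ l}

instance (n l : ℕ) : Fintype (MIdx n l) :=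
  Fintype.ofInjective
    (fun (μ : MIdx n l) (i : Fin n) => (⟨μ.1 i, Nat.lt_succ_of_le
      ((Finset.single_le_sum (f := μ.1) (fun _ _ => Nat.zero_le _)
        (Finset.mem_univ i)).trans μ.2)⟩ : Fin (l + 1)))
    (fun μ ν h => Subtype.ext (funext fun i => by simpa using congrFun h i))

/-- The multi-index `0`. -/
def MIdx.zero {n l : ℕ} : MIdx n l := ⟨0, by simp⟩

/-- `ν ↦ ν + e_i`. -/
def MIdx.succ {n l : ℕ} (ν : MIdx n l) (i : Fin n) : MIdx n (l + 1) :=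
  ⟨ν.1 + Pi.single i 1, by simpa [Finset.sum_add_distrib] using ν.2⟩

/-- A multi-index of length at most `l` as one of length at most `l + 1`. -/
def MIdx.incl {n l : ℕ} (ν : MIdx n l) : MIdx n (l + 1) := ⟨ν.1, ν.2.trans (Nat.le_succ l)⟩

/-- Fibre coordinates `φ^K_μ`, `|μ| ≤ l`, on the bundle of `l`-th jets. -/
abbrev Jets (n N l : ℕ) : Type := MIdx n l → Fin N → ℝ

/-- Momenta `p^{μ i}_K`, `|μ| ≤ k`, `1 ≤ i ≤ n`: the element
`∑ p^{μ i}_K δφ^K_μ ⊗ ∂_i ⌟ dⁿx` of the phase bundle. -/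
abbrev Mom (n N k : ℕ) : Type := MIdx n k → Fin N → Fin n → ℝ

/-- Forgetting the highest derivatives. -/
def trunc {n N l : ℕ} (u : Jets n N (l + 1)) : Jets n N l := fun ν => u ν.incl

/-- `φ_μ ↦ φ_{μ + e_i}`. -/
def shift {n N l : ℕ} (i : Fin n) (u : Jets n N (l + 1)) : Jets n N l := fun ν => u (ν.succ i)

/-! ### Differential forms on open subsets of vector spaces -/

section Forms

variable {E : Type*} [NormedAddCommGroup E] [NormedSpace ℝ E]

/-- Exterior derivative of the one-form `θ` (`θ a v` is the value at the point `a` on the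
vector `v`). -/
def extD (θ : E → E → ℝ) (a v w : E) : ℝ :=
  fderiv ℝ (fun b => θ b w) a v - fderiv ℝ (fun b => θ b v) a w

/-- `S` is an embedded smooth submanifold of the vector space `E`: near each of its points it is
straightened onto a linear subspace by a local diffeomorphism of `E`. -/
def IsEmbeddedSubmanifold (S : Set E) : Prop :=
  ∀ a ∈ S, ∃ (e : OpenPartialHomeomorph E E) (V : Submodule ℝ E),
    a ∈ e.source ∧ ContDiffOn ℝ ∞ e e.source ∧ ContDiffOn ℝ ∞ e.symm e.target ∧
      ∀ b ∈ e.source, b ∈ S ↔ e b ∈ V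

/-- Vectors tangent to `S` at `a`: velocities of smooth curves in `S`. -/
def tangentTo (S : Set E) (a : E) : Set E :=
  {v | ∃ γ : ℝ → E, ContDiffAt ℝ ∞ γ 0 ∧ γ 0 = a ∧ (∀ᶠ t in 𝓝 (0 : ℝ), γ t ∈ S) ∧
    deriv γ 0 = v}

/-- `S` is a Lagrangian submanifold for the two-form `Ω`: an embedded submanifold each of whose
tangent spaces is its own `Ω`-orthogonal complement (that is, maximal isotropic). -/
def IsLagrangian (Ω : E → E → E → ℝ) (S : Set E) : Prop :=
  IsEmbeddedSubmanifold S ∧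
    ∀ a ∈ S, ∀ v, v ∈ tangentTo S a ↔ ∀ w ∈ tangentTo S a, Ω a v w = 0

theorem extD_of_linear [FiniteDimensional ℝ E] (θ : E → E → ℝ)
    (h : ∀ w, IsLinearMap ℝ (fun a => θ a w)) (a v w : E) :
    extD θ a v w = θ v w - θ w v := by
  have key : ∀ w a v, fderiv ℝ (fun b => θ b w) a v = θ v w := by
    intro w a v
    have := (LinearMap.toContinuousLinearMap ((h w).mk' _)).hasFDerivAt (x := a)
    have h2 : HasFDerivAt (fun b => θ b w)
      (LinearMap.toContinuousLinearMap ((h w).mk' _)) a := this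
    rw [h2.fderiv]; rfl
  simp only [extD, key]

end Forms

/-! ### The fibre of the first jet-extension of the phase bundle -/

/-- Fibre coordinates on the first jet-extension of the phase bundle:
`ζ.1 = (φ_μ, p^{μ i})` and `ζ.2 j = (φ_{μ,j}, p^{μ i}_{,j})`. -/
abbrev JetPhase (n N k : ℕ) : Type :=
  (Jets n N k × Mom n N k) × (Fin n → Jets n N k × Mom n N k)

/-- The space-time differential of `θ = p^{μ i} δφ_μ ⊗ ∂_i ⌟ dⁿx`, that is
`∑ (p^{μ i} δφ_{μ,i} + p^{μ i}_{,i} δφ_μ)` (coefficient of `dⁿx`). -/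
def thetaTT {n N k : ℕ} (ζ v : JetPhase n N k) : ℝ :=
  ∑ μ : MIdx n k, ∑ K : Fin N, ∑ i : Fin n,
    (ζ.1.2 μ K i * (v.2 i).1 μ K + (ζ.2 i).2 μ K i * v.1.1 μ K)

/-- The vertical differential of `thetaTT`. -/
def omegaTT {n N k : ℕ} : JetPhase n N k → JetPhase n N k → JetPhase n N k → ℝ := extD thetaTT

/-- Fibre coordinates `(φ_μ (|μ| ≤ k + 1), p^{μ i}, p^{μ i}_{,j})` on the part of the first
jet-extension of the phase bundle which lies over the holonomic jets. -/
abbrev HolPhase (n N k : ℕ) : Type := Jets n N (k + 1) × Mom n N k × (Fin n → Mom n N k)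

/-- The inclusion given by the holonomic constraints `φ_{μ,i} = φ_{μ + e_i}`. -/
def holIncl {n N k : ℕ} (η : HolPhase n N k) : JetPhase n N k :=
  ((trunc η.1, η.2.1), fun i => (shift i η.1, η.2.2 i))

/-- Restriction of `thetaTT` to the holonomic part (the inclusion is linear). -/
def thetaT {n N k : ℕ} (η v : HolPhase n N k) : ℝ := thetaTT (holIncl η) (holIncl v)

/-- Restriction of `omegaTT` to the holonomic part. -/
def omegaT {n N k : ℕ} (η v w : HolPhase n N k) : ℝ :=
  omegaTT (holIncl η) (holIncl v) (holIncl w)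

/-! ### The infinitesimal phase bundle -/

/-- The points of the holonomic part over the open set `U` of jets. -/
abbrev HolPhaseOn {n N k : ℕ} (U : Set (Jets n N (k + 1))) : Type := {η : HolPhase n N k // η.1 ∈ U}

/-- `η'` is reached from `η` along a smooth curve tangent to the degeneracy distribution of
`omegaT`. -/
def LeafStep {n N k : ℕ} (U : Set (Jets n N (k + 1))) (η η' : HolPhaseOn U) : Prop :=
  ∃ γ : ℝ → HolPhase n N k, ContDiff ℝ ∞ γ ∧ γ 0 = η.1 ∧ γ 1 = η'.1 ∧
    ∀ t, (γ t).1 ∈ U ∧ ∀ w, omegaT (γ t) (deriv γ t) w = 0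

/-- (A fibre of) the infinitesimal phase bundle: the space of leaves of the degeneracy
distribution of `omegaT` (`Quot` passes to the equivalence relation generated by `LeafStep`). -/
def PhaseI {n N k : ℕ} (U : Set (Jets n N (k + 1))) : Type := Quot (LeafStep U)

/-- `p^{(μ)}`: the sum of all `p^{ν i}` with `ν + e_i = μ`. -/
def symPart {n N k : ℕ} (p : Mom n N k) (μ : MIdx n (k + 1)) (K : Fin N) : ℝ :=
  ∑ ν : MIdx n k, ∑ i : Fin n, if ν.succ i = μ then p ν K i else 0

/-- `p^{μ i}_{,i}` for `|μ| ≤ k`, and `0` for `|μ| = k + 1`. -/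
def divPart {n N k : ℕ} (dp : Fin n → Mom n N k) (μ : MIdx n (k + 1)) (K : Fin N) : ℝ :=
  if h : ∑ i, μ.1 i ≤ k then ∑ i : Fin n, dp i ⟨μ.1, h⟩ K i else 0

/-- The currents `j^μ_K = p^{(μ)}_K + p^{μ i}_{K,i}`, `|μ| ≤ k + 1`. -/
def current {n N k : ℕ} (η : HolPhase n N k) : Jets n N (k + 1) :=
  fun μ K => symPart η.2.1 μ K + divPart η.2.2 μ K

/-- Coordinates `(φ_μ, j^μ)`, `|μ| ≤ k + 1`, on the fibres of the infinitesimal phase bundle. -/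
abbrev PhaseICoord (n N k : ℕ) : Type := Jets n N (k + 1) × Jets n N (k + 1)

/-- `θ^I = ∑ j^μ δφ_μ` (coefficient of `dⁿx`). -/
def thetaI {n N k : ℕ} (a v : PhaseICoord n N k) : ℝ :=
  ∑ μ : MIdx n (k + 1), ∑ K : Fin N, a.2 μ K * v.1 μ K

/-- `ω^I = δθ^I = ∑ δj^μ ∧ δφ_μ` (coefficient of `dⁿx`). -/
def omegaI {n N k : ℕ} : PhaseICoord n N k → PhaseICoord n N k → PhaseICoord n N k → ℝ :=
  extD thetaI

/-- The projection `(φ_μ, p, p_{,j}) ↦ (φ_μ, j^μ)`. -/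
def toCoord {n N k : ℕ} (η : HolPhase n N k) : PhaseICoord n N k := (η.1, current η)

theorem thetaT_eq {n N k : ℕ} (η v : HolPhase n N k) :
    thetaT η v = thetaI (toCoord η) (toCoord v) := by
  have h1 : ∀ K, (∑ μ : MIdx n (k + 1), symPart η.2.1 μ K * v.1 μ K) =
      ∑ ν : MIdx n k, ∑ i : Fin n, η.2.1 ν K i * v.1 (ν.succ i) K := by
    intro K
    simp only [symPart, Finset.sum_mul]
    rw [Finset.sum_comm]
    refine Finset.sum_congr rfl fun ν _ => ?_
    rw [Finset.sum_comm]
    refine Finset.sum_congr rfl fun i _ => ?_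
    simp [ite_mul]
  have h2 : ∀ K, (∑ μ : MIdx n (k + 1), divPart η.2.2 μ K * v.1 μ K) =
      ∑ ν : MIdx n k, ∑ i : Fin n, η.2.2 i ν K i * v.1 ν.incl K := by
    intro K
    have inj : Function.Injective (MIdx.incl : MIdx n k → MIdx n (k + 1)) := by
      intro a b h
      exact Subtype.ext (congrArg (fun c : MIdx n (k + 1) => c.1) h)
    rw [← Finset.sum_subset (Finset.subset_univ (Finset.univ.image MIdx.incl)),
      Finset.sum_image fun a _ b _ h => inj h]
    · refine Finset.sum_congr rfl fun ν _ => ?_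
      have : ∑ i, ν.incl.1 i ≤ k := ν.2
      simp only [divPart, dif_pos this, Finset.sum_mul]
      rfl
    · intro μ _ hμ
      have : ¬ ∑ i, μ.1 i ≤ k := fun h => hμ (Finset.mem_image.2 ⟨⟨μ.1, h⟩, Finset.mem_univ _, rfl⟩)
      simp [divPart, this]
  calc thetaT η v = ∑ K, ((∑ ν : MIdx n k, ∑ i : Fin n, η.2.1 ν K i * v.1 (ν.succ i) K) +
        ∑ ν : MIdx n k, ∑ i : Fin n, η.2.2 i ν K i * v.1 ν.incl K) := by
        simp only [thetaT, thetaTT, holIncl, trunc, shift, Finset.sum_add_distrib]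
        congr 1 <;> rw [Finset.sum_comm]
    _ = _ := by
        simp only [← h1, ← h2, ← Finset.sum_add_distrib, ← add_mul]
        rw [Finset.sum_comm]
        rfl

theorem current_isLinearMap {n N k : ℕ} :
    IsLinearMap ℝ (current : HolPhase n N k → Jets n N (k + 1)) := by
  constructor
  · intro a b
    funext μ K
    have hs : symPart (a + b).2.1 μ K = symPart a.2.1 μ K + symPart b.2.1 μ K := by
      simp only [symPart, ← Finset.sum_add_distrib]
      refine Finset.sum_congr rfl fun ν _ => Finset.sum_congr rfl fun i _ => ?_
      split_ifs <;> simp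
    have hd : divPart (a + b).2.2 μ K = divPart a.2.2 μ K + divPart b.2.2 μ K := by
      simp only [divPart]
      split_ifs <;> simp [Finset.sum_add_distrib]
    show symPart _ μ K + divPart _ μ K = (symPart _ μ K + divPart _ μ K) +
      (symPart _ μ K + divPart _ μ K)
    rw [hs, hd]; ring
  · intro c a
    funext μ K
    simp only [current, symPart, divPart, Prod.smul_snd, Prod.smul_fst, Pi.smul_apply,
      smul_eq_mul, mul_add, Finset.mul_sum, mul_ite, mul_zero, mul_dite]

theorem thetaI_isLinearMap {n N k : ℕ} (w : PhaseICoord n N k) :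
    IsLinearMap ℝ (fun a : PhaseICoord n N k => thetaI a w) := by
  constructor
  · intro a b
    simp [thetaI, add_mul, Finset.sum_add_distrib]
  · intro c a
    simp [thetaI, mul_assoc, Finset.mul_sum]

theorem thetaTT_isLinearMap {n N k : ℕ} (w : JetPhase n N k) :
    IsLinearMap ℝ (fun ζ : JetPhase n N k => thetaTT ζ w) := by
  constructor
  · intro a b
    simp only [thetaTT, ← Finset.sum_add_distrib]
    refine Finset.sum_congr rfl fun μ _ => Finset.sum_congr rfl fun K _ =>
      Finset.sum_congr rfl fun i _ => ?_
    simp only [Prod.snd_add, Prod.fst_add, Pi.add_apply]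
    ring
  · intro c a
    simp only [thetaTT, smul_eq_mul, Finset.mul_sum]
    refine Finset.sum_congr rfl fun μ _ => Finset.sum_congr rfl fun K _ =>
      Finset.sum_congr rfl fun i _ => ?_
    simp only [Prod.smul_snd, Prod.smul_fst, Pi.smul_apply, smul_eq_mul]
    ring

/-- `omegaT` is the pull-back of `omegaI`, so that `omegaI` is its reduction. -/
theorem omegaT_eq {n N k : ℕ} (η v w : HolPhase n N k) :
    omegaT η v w = omegaI (toCoord η) (toCoord v) (toCoord w) := by
  rw [omegaT, omegaTT, extD_of_linear _ thetaTT_isLinearMap, omegaI,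
    extD_of_linear _ thetaI_isLinearMap, ← thetaT_eq, ← thetaT_eq]
  rfl

theorem omegaI_apply {n N k : ℕ} (a v w : PhaseICoord n N k) :
    omegaI a v w = ∑ μ : MIdx n (k + 1), ∑ K : Fin N,
      (v.2 μ K * w.1 μ K - w.2 μ K * v.1 μ K) := by
  rw [omegaI, extD_of_linear _ thetaI_isLinearMap]
  simp only [thetaI, Finset.sum_sub_distrib]

/-- `omegaI` is nondegenerate. -/
theorem omegaI_nondegenerate {n N k : ℕ} (a v : PhaseICoord n N k)
    (h : ∀ w, omegaI a v w = 0) : v = 0 := by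
  have h1 := h (v.2, 0)
  have h2 := h (0, v.1)
  rw [omegaI_apply] at h1 h2
  have z1 : ∀ μ K, v.2 μ K = 0 := by
    intro μ K
    simp only [Pi.zero_apply, zero_mul, sub_zero] at h1
    have := (Finset.sum_eq_zero_iff_of_nonneg (fun μ _ =>
      Finset.sum_nonneg fun K _ => mul_self_nonneg (v.2 μ K))).1 h1 μ (Finset.mem_univ _)
    have := (Finset.sum_eq_zero_iff_of_nonneg (fun K _ =>
      mul_self_nonneg (v.2 μ K))).1 this K (Finset.mem_univ _)
    exact mul_self_eq_zero.1 this
  have z2 : ∀ μ K, v.1 μ K = 0 := by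
    intro μ K
    simp only [Pi.zero_apply, mul_zero, zero_sub, Finset.sum_neg_distrib, neg_eq_zero] at h2
    have := (Finset.sum_eq_zero_iff_of_nonneg (fun μ _ =>
      Finset.sum_nonneg fun K _ => mul_self_nonneg (v.1 μ K))).1 h2 μ (Finset.mem_univ _)
    have := (Finset.sum_eq_zero_iff_of_nonneg (fun K _ =>
      mul_self_nonneg (v.1 μ K))).1 this K (Finset.mem_univ _)
    exact mul_self_eq_zero.1 this
  exact Prod.ext (funext fun μ => funext fun K => z2 μ K) (funext fun μ => funext fun K => z1 μ K)

theorem toCoord_surjective {n N k : ℕ} [NeZero n] (a : PhaseICoord n N k) :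
    ∃ η : HolPhase n N k, toCoord η = a := by
  classical
  let pick : MIdx n (k + 1) → Fin n := fun μ => if h : ∃ i, 0 < μ.1 i then h.choose else 0
  let p : Mom n N k := fun ν K i => if i = pick (ν.succ i) then a.2 (ν.succ i) K else 0
  let q : Fin n → Mom n N k := fun j ν K i =>
    if j = 0 ∧ i = 0 then a.2 ν.incl K - symPart p ν.incl K else 0
  refine ⟨(a.1, p, q), Prod.ext rfl ?_⟩
  funext μ K
  show symPart p μ K + divPart q μ K = a.2 μ K
  by_cases h : ∑ i, μ.1 i ≤ k
  · have e : MIdx.incl ⟨μ.1, h⟩ = μ := rfl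
    have : divPart q μ K = a.2 μ K - symPart p μ K := by
      simp only [divPart, dif_pos h, q, and_self]
      rw [Finset.sum_ite_eq' Finset.univ 0, if_pos (Finset.mem_univ _), e]
    rw [this]; ring
  · have hd : divPart q μ K = 0 := by simp [divPart, h]
    have hex : ∃ i, 0 < μ.1 i := by
      by_contra! hc
      exact h ((Finset.sum_eq_zero fun i _ => Nat.le_zero.1 (hc i)).le.trans (Nat.zero_le _))
    have hpick : 0 < μ.1 (pick μ) := by
      simp only [pick, dif_pos hex]; exact hex.choose_spec
    have hsub : μ.1 - Pi.single (pick μ) 1 + Pi.single (pick μ) 1 = μ.1 := by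
      funext i
      by_cases hi : i = pick μ
      · subst hi; simp; omega
      · simp [hi]
    have hle : ∑ i, (μ.1 - Pi.single (pick μ) 1 : Fin n → ℕ) i ≤ k := by
      have h1 := congrArg (fun f : Fin n → ℕ => ∑ i, f i) hsub
      simp only [Pi.add_apply, Finset.sum_add_distrib, Finset.sum_pi_single', Finset.mem_univ,
        if_true] at h1
      have h2 := μ.2
      omega
    have hs : symPart p μ K = a.2 μ K := by
      rw [symPart, Finset.sum_eq_single (⟨_, hle⟩ : MIdx n k),
        Finset.sum_eq_single (pick μ)]
      · have e : MIdx.succ ⟨_, hle⟩ (pick μ) = μ := Subtype.ext hsub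
        rw [if_pos e]
        simp only [p, e, if_true]
      · intro i _ hi
        split_ifs with e
        · simp only [p, e, if_neg hi]
        · rfl
      · simp
      · intro ν _ hν
        refine Finset.sum_eq_zero fun i _ => ?_
        split_ifs with e
        · simp only [p, e]
          refine if_neg fun hi => hν (Subtype.ext ?_)
          have := congrArg Subtype.val e
          subst hi
          show ν.1 = μ.1 - _
          rw [← this]
          show ν.1 = ν.1 + Pi.single (pick μ) 1 - Pi.single (pick μ) 1
          simp
        · rfl
      · simp
    rw [hs, hd, add_zero]

/-- The degeneracy distribution of `omegaT` is the kernel of the projection `toCoord`. -/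
theorem degenerate_iff {n N k : ℕ} [NeZero n] (η v : HolPhase n N k) :
    (∀ w, omegaT η v w = 0) ↔ toCoord v = 0 := by
  constructor
  · intro h
    refine omegaI_nondegenerate (toCoord η) _ fun w => ?_
    obtain ⟨w, rfl⟩ := toCoord_surjective w
    rw [← omegaT_eq, h]
  · intro h w
    rw [omegaT_eq, h, omegaI_apply]
    simp

theorem toCoord_isLinearMap {n N k : ℕ} :
    IsLinearMap ℝ (toCoord : HolPhase n N k → PhaseICoord n N k) :=
  ⟨fun a b => Prod.ext rfl (current_isLinearMap.map_add a b),
    fun c a => Prod.ext rfl (current_isLinearMap.map_smul c a)⟩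

theorem leafStep_iff {n N k : ℕ} [NeZero n] (U : Set (Jets n N (k + 1))) (η η' : HolPhaseOn U) :
    LeafStep U η η' ↔ toCoord η.1 = toCoord η'.1 := by
  constructor
  · rintro ⟨γ, hγ, h0, h1, h⟩
    let T := LinearMap.toContinuousLinearMap ((toCoord_isLinearMap (n := n) (N := N) (k := k)).mk' _)
    have hd : ∀ t, HasDerivAt (fun s => T (γ s)) 0 t := by
      intro t
      have := T.hasFDerivAt.comp_hasDerivAt t (hγ.differentiable (by simp) t).hasDerivAt
      have e : T (deriv γ t) = 0 := (degenerate_iff (γ t) _).1 (h t).2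
      rwa [e] at this
    have := is_const_of_deriv_eq_zero (fun t => (hd t).differentiableAt)
      (fun t => (hd t).deriv) 0 1
    have h2 : T (γ 0) = T (γ 1) := this
    rw [h0, h1] at h2
    exact h2
  · intro h
    refine ⟨fun t => η.1 + t • (η'.1 - η.1), by fun_prop, by simp, by simp, fun t => ⟨?_, ?_⟩⟩
    · have : η.1.1 = η'.1.1 := congrArg (fun c : PhaseICoord n N k => c.1) h
      have e : (η.1 + t • (η'.1 - η.1)).1 = η.1.1 := by simp [this]
      show (η.1 + t • (η'.1 - η.1)).1 ∈ U
      rw [e]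
      exact η.2
    · have hd : deriv (fun t : ℝ => η.1 + t • (η'.1 - η.1)) t = η'.1 - η.1 := by
        have := ((hasDerivAt_id t).smul_const (η'.1 - η.1)).const_add η.1
        simpa using this.deriv
      rw [hd, degenerate_iff, toCoord_isLinearMap.map_sub, h, sub_self]

/-- The coordinates `(φ_μ, j^μ)` identify the leaf space with `{(φ, j) | φ ∈ U}`; they define its
smooth structure, and identify it with the bundle of covectors `∑ j^μ δφ_μ` over `U`. -/
def PhaseI.coord {n N k : ℕ} [NeZero n] (U : Set (Jets n N (k + 1))) :
    PhaseI U ≃ {a : PhaseICoord n N k // a.1 ∈ U} :=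
  Equiv.ofBijective
    (Quot.lift (fun η => ⟨toCoord η.1, η.2⟩)
      (fun η η' h => Subtype.ext ((leafStep_iff U η η').1 h)))
    ⟨by
      rintro ⟨η⟩ ⟨η'⟩ h
      exact Quot.sound ((leafStep_iff U η η').2 (congrArg Subtype.val h)),
    fun a => by
      obtain ⟨η, hη⟩ := toCoord_surjective a.1
      exact ⟨Quot.mk _ ⟨η, by simpa [← hη, toCoord] using a.2⟩, Subtype.ext hη⟩⟩

/-! ### Fibred manifolds, fibred charts, jets of sections -/

section Bundle

variable {n N : ℕ} {M Φ : Type*} [TopologicalSpace M] [ChartedSpace (Fin n → ℝ) M]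
  [TopologicalSpace Φ] [ChartedSpace ((Fin n → ℝ) × (Fin N → ℝ)) Φ]

/-- A fibred chart `(x^i, φ^K)` of `π : Φ → M`: a smooth chart of `Φ` over a smooth chart of `M`. -/
structure FibredChart (n N : ℕ) {M Φ : Type*} [TopologicalSpace M]
    [ChartedSpace (Fin n → ℝ) M] [TopologicalSpace Φ]
    [ChartedSpace ((Fin n → ℝ) × (Fin N → ℝ)) Φ] (π : Φ → M) where
  base : OpenPartialHomeomorph M (Fin n → ℝ)
  tot : OpenPartialHomeomorph Φ ((Fin n → ℝ) × (Fin N → ℝ))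
  base_mem : base ∈ IsManifold.maximalAtlas 𝓘(ℝ, Fin n → ℝ) ∞ M
  tot_mem : tot ∈ IsManifold.maximalAtlas 𝓘(ℝ, (Fin n → ℝ) × (Fin N → ℝ)) ∞ Φ
  proj_mem : ∀ y ∈ tot.source, π y ∈ base.source
  proj_eq : ∀ y ∈ tot.source, (tot y).1 = base (π y)

/-- `π` is covered by fibred charts (that is, `π` is a smooth submersion). Every smooth fibre bundle
with base of dimension `n` and fibres of dimension `N` is of this kind. -/
def IsFibred (n N : ℕ) {M Φ : Type*} [TopologicalSpace M]
    [ChartedSpace (Fin n → ℝ) M] [TopologicalSpace Φ]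
    [ChartedSpace ((Fin n → ℝ) × (Fin N → ℝ)) Φ] (π : Φ → M) : Prop :=
  ∀ y : Φ, ∃ c : FibredChart n N π, y ∈ c.tot.source

/-- `s` is a smooth section of `π` over the set `O`. -/
def IsSectionOn (n N : ℕ) {M Φ : Type*} [TopologicalSpace M]
    [ChartedSpace (Fin n → ℝ) M] [TopologicalSpace Φ]
    [ChartedSpace ((Fin n → ℝ) × (Fin N → ℝ)) Φ] (π : Φ → M) (O : Set M) (s : M → Φ) : Prop :=
  ContMDiffOn 𝓘(ℝ, Fin n → ℝ) 𝓘(ℝ, (Fin n → ℝ) × (Fin N → ℝ)) ∞ s O ∧ ∀ x ∈ O, π (s x) = x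

namespace FibredChart

variable {π : Φ → M} (c : FibredChart n N π)

/-- `∂_i g` for a (vector-valued) function `g` on the domain of the chart of `M`. -/
def pd {F : Type*} [NormedAddCommGroup F] [NormedSpace ℝ F] (i : Fin n) (g : M → F) : M → F :=
  fun x => fderiv ℝ (g ∘ c.base.symm) (c.base x) (Pi.single i 1)

/-- `∂_μ g = ∂_1^{μ_1} ⋯ ∂_n^{μ_n} g`. -/
def pdMulti {F : Type*} [NormedAddCommGroup F] [NormedSpace ℝ F] (μ : Fin n → ℕ) (g : M → F) :
    M → F :=
  (List.finRange n).foldr (fun i h => (c.pd i)^[μ i] h) g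

/-- Coordinates `φ^K_μ = ∂_μ (φ^K ∘ s)`, `|μ| ≤ l`, of the `l`-jet of the section `s` at `x`. -/
def prolong (l : ℕ) (s : M → Φ) (x : M) : Jets n N l :=
  fun μ K => c.pdMulti μ.1 (fun y => (c.tot (s y)).2 K) x

/-- The coordinates of the `l`-jets at `x` which lie in the domain of the chart. -/
def jetDom (l : ℕ) (x : M) : Set (Jets n N l) := {u | (c.base x, u MIdx.zero) ∈ c.tot.target}

end FibredChart

/-- Smooth sections of `π` defined near `x`. -/
abbrev GermRep (n N : ℕ) {M Φ : Type*} [TopologicalSpace M]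
    [ChartedSpace (Fin n → ℝ) M] [TopologicalSpace Φ]
    [ChartedSpace ((Fin n → ℝ) × (Fin N → ℝ)) Φ] (π : Φ → M) (x : M) : Type _ :=
  {s : M → Φ // ∃ O : Set M, IsOpen O ∧ x ∈ O ∧ IsSectionOn n N π O s}

/-- Two sections have the same `l`-jet at `x` if they have the same value and the same partial
derivatives up to order `l` at `x`, in fibred charts. -/
def jetSetoid (n N : ℕ) {M Φ : Type*} [TopologicalSpace M]
    [ChartedSpace (Fin n → ℝ) M] [TopologicalSpace Φ]
    [ChartedSpace ((Fin n → ℝ) × (Fin N → ℝ)) Φ] (π : Φ → M) (l : ℕ) (x : M) :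
    Setoid (GermRep n N π x) where
  r s s' := s.1 x = s'.1 x ∧ ∀ c : FibredChart n N π, s.1 x ∈ c.tot.source →
    c.prolong l s.1 x = c.prolong l s'.1 x
  iseqv := ⟨fun _ => ⟨rfl, fun _ _ => rfl⟩,
    fun h => ⟨h.1.symm, fun c hc => (h.2 c (h.1 ▸ hc)).symm⟩,
    fun h h' => ⟨h.1.trans h'.1, fun c hc => (h.2 c hc).trans (h'.2 c (h.1 ▸ hc))⟩⟩

/-- The fibre over `x ∈ M` of the bundle of `l`-jets of sections of `π`. -/
def Jet (n N : ℕ) {M Φ : Type*} [TopologicalSpace M]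
    [ChartedSpace (Fin n → ℝ) M] [TopologicalSpace Φ]
    [ChartedSpace ((Fin n → ℝ) × (Fin N → ℝ)) Φ] (π : Φ → M) (l : ℕ) (x : M) : Type _ :=
  Quotient (jetSetoid n N π l x)

/-- The jet `q` lies in the domain of the fibred chart `c` and has the coordinates `u` there. -/
def FibredChart.HasCoord {π : Φ → M} (c : FibredChart n N π) {l : ℕ} {x : M} (q : Jet n N π l x)
    (u : Jets n N l) : Prop :=
  ∃ s : GermRep n N π x, Quotient.mk (jetSetoid n N π l x) s = q ∧ s.1 x ∈ c.tot.source ∧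
    c.prolong l s.1 x = u

open Classical in
/-- The function `L` with `𝓛 = L dⁿx` in the fibred chart `c`: at `(z, u)` it is the value of `𝓛` on
the jet with coordinates `(z, u)`, evaluated on the coordinate frame `∂_1, …, ∂_n`. -/
def coordRep {π : Φ → M} {l : ℕ}
    (𝓛 : ∀ x : M, Jet n N π l x → (TangentSpace 𝓘(ℝ, Fin n → ℝ) x) [⋀^Fin n]→L[ℝ] ℝ)
    (c : FibredChart n N π) (a : (Fin n → ℝ) × Jets n N l) : ℝ :=
  if h : ∃ q : Jet n N π l (c.base.symm a.1), c.HasCoord q a.2 then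
    𝓛 (c.base.symm a.1) h.choose
      (fun i => mfderiv 𝓘(ℝ, Fin n → ℝ) 𝓘(ℝ, Fin n → ℝ) c.base.symm a.1 (Pi.single i 1))
  else 0

/-- Smooth Lagrangian densities of order `l`: smooth fibre-preserving maps from the bundle of
`l`-jets to the bundle of `n`-forms on `M`. -/
structure LagrangianDensity (n N : ℕ) {M Φ : Type*} [TopologicalSpace M]
    [ChartedSpace (Fin n → ℝ) M] [TopologicalSpace Φ]
    [ChartedSpace ((Fin n → ℝ) × (Fin N → ℝ)) Φ] (π : Φ → M) (l : ℕ) where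
  toFun : ∀ x : M, Jet n N π l x → (TangentSpace 𝓘(ℝ, Fin n → ℝ) x) [⋀^Fin n]→L[ℝ] ℝ
  smooth : ∀ c : FibredChart n N π,
    ContDiffOn ℝ ∞ (coordRep toFun c) {a | (a.1, a.2 MIdx.zero) ∈ c.tot.target}

variable {π : Φ → M} {k : ℕ}

/-- `L` on the fibre over `x` of the bundle of jets, in the fibred chart `c`. -/
def LagrangianDensity.fib {l : ℕ} (𝓛 : LagrangianDensity n N π l) (c : FibredChart n N π) (x : M)
    (u : Jets n N l) : ℝ :=
  coordRep 𝓛.toFun c (c.base x, u)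

/-- `∂L/∂φ^K_μ`. -/
def LagrangianDensity.dL {l : ℕ} (𝓛 : LagrangianDensity n N π l) (c : FibredChart n N π) (x : M)
    (u : Jets n N l) (μ : MIdx n l) (K : Fin N) : ℝ :=
  fderiv ℝ (𝓛.fib c x) u (Pi.single μ (Pi.single K 1))

/-! ### The submanifold generated by a Lagrangian density

The fibre over `x` of the infinitesimal phase bundle (over the domain of the fibred chart `c`) is
`PhaseI (c.jetDom (k + 1) x)`. -/

/-- The set of coordinates of the points of `S`. -/
def coordImage [NeZero n] {U : Set (Jets n N (k + 1))} (S : Set (PhaseI U)) :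
    Set (PhaseICoord n N k) :=
  (fun a => (PhaseI.coord U a).1) '' S

/-- `𝓓_x`: the graph of `δ𝓛_x`, where a point with coordinates `(φ, j)` is identified with the
covector `∑ j^μ δφ_μ` at `φ`. -/
def dynamics [NeZero n] (𝓛 : LagrangianDensity n N π (k + 1)) (c : FibredChart n N π) (x : M) :
    Set (PhaseI (c.jetDom (k + 1) x)) :=
  {a | ∀ v : Jets n N (k + 1),
    ∑ μ, ∑ K, (PhaseI.coord _ a).1.2 μ K * v μ K =
      fderiv ℝ (𝓛.fib c x) (PhaseI.coord _ a).1.1 v}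

/-- The generating formula `δ𝓛 = θ^I|_S`: on vectors tangent to `S`, the form `θ^I` agrees with the
differential of `𝓛_x`, pulled back along the projection `(φ, j) ↦ φ`. -/
def GeneratingFormula [NeZero n] (𝓛 : LagrangianDensity n N π (k + 1)) (c : FibredChart n N π)
    (x : M) (S : Set (PhaseI (c.jetDom (k + 1) x))) : Prop :=
  ∀ a ∈ coordImage S, ∀ v ∈ tangentTo (coordImage S) a,
    thetaI a v = fderiv ℝ (𝓛.fib c x) a.1 v.1

/-- `S` is the image of a smooth section of `(φ, j) ↦ φ`. -/
def IsSmoothSectionImage [NeZero n] {U : Set (Jets n N (k + 1))} (S : Set (PhaseI U)) : Prop :=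
  ∃ α : Jets n N (k + 1) → Jets n N (k + 1), ContDiffOn ℝ ∞ α U ∧
    coordImage S = {a | a.1 ∈ U ∧ a.2 = α a.1}

/-! ### The submanifold as a partial differential equation -/

/-- `σ` gives the coordinates `(φ_μ, p^{μ i})`, in the fibred chart `c`, of a smooth section of the
phase bundle over `O`. -/
def IsPhaseSection (c : FibredChart n N π) (O : Set M) (σ : M → Jets n N k × Mom n N k) : Prop :=
  ContMDiffOn 𝓘(ℝ, Fin n → ℝ) 𝓘(ℝ, Jets n N k × Mom n N k) ∞ σ O ∧
    ∀ x ∈ O, (σ x).1 ∈ c.jetDom k x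

/-- `σ` satisfies the equation `𝓓` at `x`: its first jet at `x` is holonomic, and the class of this
jet in the infinitesimal phase bundle belongs to `𝓓_x`. -/
def SolvesAt [NeZero n] (𝓛 : LagrangianDensity n N π (k + 1)) (c : FibredChart n N π)
    (σ : M → Jets n N k × Mom n N k) (x : M) : Prop :=
  ∃ η : HolPhaseOn (c.jetDom (k + 1) x),
    holIncl η.1 = (σ x, fun i => c.pd i σ x) ∧ Quot.mk _ η ∈ dynamics 𝓛 c x

/-- The equation `p^{(μ)}_K = ∂L/∂φ^K_μ - ∂_i p^{μ i}_K` along the jets of the section `s`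
of `π`; the second term is absent for `|μ| = k + 1`, and `p^{(μ)} = 0` for `μ = 0`. -/
def MomentumEq (𝓛 : LagrangianDensity n N π (k + 1)) (c : FibredChart n N π)
    (s : M → Φ) (σ : M → Jets n N k × Mom n N k) (x : M) (μ : MIdx n (k + 1)) : Prop :=
  ∀ K, symPart (σ x).2 μ K =
    𝓛.dL c x (c.prolong (k + 1) s x) μ K - divPart (fun i => c.pd i (fun y => (σ y).2) x) μ K

/-- The Euler–Lagrange equations `∑_{|μ| ≤ l} (-1)^{|μ|} ∂_μ (∂L/∂φ^K_μ) = 0` at `x`. -/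
def EulerLagrangeAt {l : ℕ} (𝓛 : LagrangianDensity n N π l) (c : FibredChart n N π)
    (s : M → Φ) (x : M) : Prop :=
  ∀ K, ∑ μ : MIdx n l, (-1 : ℝ) ^ (∑ i, μ.1 i) *
    c.pdMulti μ.1 (fun y => 𝓛.dL c y (c.prolong l s y) μ K) x = 0

/-- Totally symmetric momenta. In terms of totally symmetric tensors `s`, multi-index components are
`p^{ν i} = (|ν|! / ν!) s^{ν + e_i}`, so that `ν! p^{ν i}` depends on `ν + e_i` only. -/
def IsSymmetric (p : Mom n N k) : Prop :=
  ∀ (ν ν' : MIdx n k) (i i' : Fin n), ν.succ i = ν'.succ i' → ∀ K,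
    (∏ m, (ν.1 m).factorial : ℕ) * p ν K i = (∏ m, (ν'.1 m).factorial : ℕ) * p ν' K i'

end Bundle

end HOVar

end

noncomputable section

namespace HOVar

/-! In the coordinates `(φ, j)` of the infinitesimal phase bundle, `dynamics` is the graph `j =
∂L/∂φ`. A vector tangent to a graph `j = α(φ)` is `(v, Dα v)`, and `thetaI` pairs it to `⟨α, v⟩`; as
`v` is arbitrary, the generating formula forces `α = ∂L/∂φ` (`generatingFormula_iff`). The graph is
Lagrangian because the Hessian of `L` is symmetric (`isLagrangian_graph_gradient`).

As a differential equation, membership in the graph says that the current `p^{(μ)} + ∂_i p^{μ i}`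
equals `∂L/∂φ_μ`, which is the momentum equation, while holonomy says `φ_{μ+e_i} = ∂_i φ_μ`; hence
the field part is a prolongation (`eq_pdMulti_of_solvesAt`, `solvesAt_iff_momentumEq`).

The link with the Euler–Lagrange equations is that `∑ (-1)^{|μ|} ∂_μ` kills every current
(`sum_pdMulti_current`). Each `p^{ν i}` enters twice, undifferentiated in `j^{ν+e_i}` and as `∂_i
p^{ν i}` in `j^ν`; both give `∂_{ν+e_i} p^{ν i}`, with opposite signs. If the equations with `μ ≠ 0`
hold, the Euler–Lagrange expression is therefore the defect of the one with `μ = 0`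
(`eulerLagrange_sum_eq`).

For existence and uniqueness of symmetric momenta, put `p^{ν i} = (ν_i + 1)/(|ν| + 1) P_{ν+e_i}`.
The weights of the pairs with `ν + e_i = μ` are `μ_i/|μ|` and add up to `1`, so `p^{(μ)} = P_μ`, and
the momentum equations become a recursion determining `P_μ` downwards from `|μ| = k + 1`
(`exists_symmetric_momenta`, `symmetric_momenta_unique`). -/

theorem minSmoothness_two_le_infty : minSmoothness ℝ 2 ≤ (∞ : WithTop ℕ∞) := by
  rw [minSmoothness_of_isRCLikeNormedField]
  exact WithTop.coe_le_coe.2 (le_top : (2 : ℕ∞) ≤ ⊤)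

/-! ### Partial derivatives in a chart of the base, single and iterated. -/

section ChartCalculus

variable {n N : ℕ} {M Φ : Type*} [TopologicalSpace M] [ChartedSpace (Fin n → ℝ) M]
  [TopologicalSpace Φ] [ChartedSpace ((Fin n → ℝ) × (Fin N → ℝ)) Φ] {π : Φ → M}
  {F G : Type*} [NormedAddCommGroup F] [NormedSpace ℝ F] [NormedAddCommGroup G] [NormedSpace ℝ G]

namespace FibredChart

variable (c : FibredChart n N π)

/-- The image of `O` in the chart of the base. -/
def chartImage (O : Set M) : Set (Fin n → ℝ) := c.base.target ∩ c.base.symm ⁻¹' O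

/-- Smoothness of `g` on `O`, read in the chart of the base. -/
def SmoothIn (O : Set M) (g : M → F) : Prop := ContDiffOn ℝ ∞ (g ∘ c.base.symm) (c.chartImage O)

variable {c} {O : Set M}

theorem isOpen_chartImage (hO : IsOpen O) : IsOpen (c.chartImage O) :=
  c.base.isOpen_inter_preimage_symm hO

theorem base_mem_chartImage (hs : O ⊆ c.base.source) {x : M} (hx : x ∈ O) :
    c.base x ∈ c.chartImage O :=
  ⟨c.base.map_source (hs hx), by simpa [c.base.left_inv (hs hx)] using hx⟩

theorem SmoothIn.congr {g h : M → F} (hg : c.SmoothIn O g) (e : Set.EqOn h g O) :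
    c.SmoothIn O h :=
  ContDiffOn.congr hg fun _ hz => e hz.2

theorem SmoothIn.clm {g : M → F} (hg : c.SmoothIn O g) (T : F →L[ℝ] G) :
    c.SmoothIn O (fun x => T (g x)) :=
  T.contDiff.comp_contDiffOn hg

theorem SmoothIn.differentiableAt (hO : IsOpen O) {g : M → F} (hg : c.SmoothIn O g)
    {z : Fin n → ℝ} (hz : z ∈ c.chartImage O) : DifferentiableAt ℝ (g ∘ c.base.symm) z :=
  (ContDiffOn.contDiffAt hg ((isOpen_chartImage hO).mem_nhds hz)).differentiableAt (by simp)

theorem pd_congr (hO : IsOpen O) (hs : O ⊆ c.base.source) {g h : M → F} (e : Set.EqOn g h O)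
    (i : Fin n) : Set.EqOn (c.pd i g) (c.pd i h) O := by
  intro x hx
  have : (g ∘ c.base.symm) =ᶠ[𝓝 (c.base x)] (h ∘ c.base.symm) :=
    Filter.eventuallyEq_of_mem
      ((isOpen_chartImage hO).mem_nhds (base_mem_chartImage hs hx)) fun z hz => e hz.2
  simp only [pd, this.fderiv_eq]

/-- Lets iterated `pd` be computed as iterated Fréchet derivatives on an open subset of `Fin n → ℝ`.
-/
theorem pd_comp_symm {g : M → F} (i : Fin n) : Set.EqOn (c.pd i g ∘ c.base.symm)
    (fun z => fderiv ℝ (g ∘ c.base.symm) z (Pi.single i 1)) (c.chartImage O) := by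
  intro z hz
  simp only [pd, Function.comp_apply, c.base.right_inv hz.1]

theorem SmoothIn.pd (hO : IsOpen O) {g : M → F} (hg : c.SmoothIn O g) (i : Fin n) :
    c.SmoothIn O (c.pd i g) := by
  have h1 : ContDiffOn ℝ ∞ (fderiv ℝ (g ∘ c.base.symm)) (c.chartImage O) :=
    ContDiffOn.fderiv_of_isOpen hg (isOpen_chartImage hO) (by simp)
  exact (h1.clm_apply contDiffOn_const).congr (pd_comp_symm i)

/-- Both sides are the second Fréchet derivative on two basis vectors, which is symmetric for smooth
functions. -/
theorem pd_comm (hO : IsOpen O) (hs : O ⊆ c.base.source) {g : M → F} (hg : c.SmoothIn O g)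
    (i j : Fin n) : Set.EqOn (c.pd i (c.pd j g)) (c.pd j (c.pd i g)) O := by
  have key : ∀ i j, ∀ x ∈ O, c.pd i (c.pd j g) x =
      fderiv ℝ (fderiv ℝ (g ∘ c.base.symm)) (c.base x) (Pi.single i 1) (Pi.single j 1) := by
    intro i j x hx
    have hz := base_mem_chartImage hs hx
    have hn := (isOpen_chartImage hO).mem_nhds hz
    have h1 : ContDiffOn ℝ ∞ (fderiv ℝ (g ∘ c.base.symm)) (c.chartImage O) :=
      ContDiffOn.fderiv_of_isOpen hg (isOpen_chartImage hO) (by simp)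
    have h2 : DifferentiableAt ℝ (fderiv ℝ (g ∘ c.base.symm)) (c.base x) :=
      (h1.contDiffAt hn).differentiableAt (by simp)
    have h3 : (c.pd j g ∘ c.base.symm) =ᶠ[𝓝 (c.base x)]
        (fun z => fderiv ℝ (g ∘ c.base.symm) z (Pi.single j 1)) :=
      Filter.eventuallyEq_of_mem hn (pd_comp_symm j)
    have h4 : HasFDerivAt (fun z => fderiv ℝ (g ∘ c.base.symm) z (Pi.single j 1))
        ((fderiv ℝ (fderiv ℝ (g ∘ c.base.symm)) (c.base x)).flip (Pi.single j 1)) (c.base x) := by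
      have := h2.hasFDerivAt.clm_apply
        (hasFDerivAt_const (Pi.single j (1 : ℝ) : Fin n → ℝ) (c.base x))
      simpa using this
    rw [FibredChart.pd, h3.fderiv_eq, h4.fderiv]
    rfl
  intro x hx
  have hz := base_mem_chartImage hs hx
  have h5 := (ContDiffOn.contDiffAt hg ((isOpen_chartImage hO).mem_nhds hz)).isSymmSndFDerivAt
    minSmoothness_two_le_infty
  rw [key i j x hx, key j i x hx]
  exact h5 _ _

theorem pd_clm (hO : IsOpen O) (hs : O ⊆ c.base.source) {g : M → F} (hg : c.SmoothIn O g)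
    (T : F →L[ℝ] G) (i : Fin n) {x : M} (hx : x ∈ O) :
    c.pd i (fun y => T (g y)) x = T (c.pd i g x) := by
  have := T.hasFDerivAt.comp _ (hg.differentiableAt hO (base_mem_chartImage hs hx)).hasFDerivAt
  exact congrArg (fun A : (Fin n → ℝ) →L[ℝ] G => A (Pi.single i 1)) this.fderiv

theorem SmoothIn.prodMk {g : M → F} {h : M → G} (hg : c.SmoothIn O g) (hh : c.SmoothIn O h) :
    c.SmoothIn O (fun x => (g x, h x)) :=
  ContDiffOn.prodMk hg hh

theorem smoothIn_pi {ι : Type*} [Fintype ι] {E : ι → Type*} [∀ i, NormedAddCommGroup (E i)]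
    [∀ i, NormedSpace ℝ (E i)] {g : M → ∀ i, E i} :
    c.SmoothIn O g ↔ ∀ i, c.SmoothIn O (fun x => g x i) :=
  contDiffOn_pi

theorem SmoothIn.add {g h : M → F} (hg : c.SmoothIn O g) (hh : c.SmoothIn O h) :
    c.SmoothIn O (fun x => g x + h x) :=
  ContDiffOn.add hg hh

theorem SmoothIn.sub {g h : M → F} (hg : c.SmoothIn O g) (hh : c.SmoothIn O h) :
    c.SmoothIn O (fun x => g x - h x) :=
  ContDiffOn.sub hg hh

theorem SmoothIn.const_mul {g : M → ℝ} (hg : c.SmoothIn O g) (r : ℝ) :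
    c.SmoothIn O (fun x => r * g x) :=
  ContDiffOn.mul contDiffOn_const hg

theorem smoothIn_const (r : F) : c.SmoothIn O (fun _ => r) :=
  contDiffOn_const

theorem SmoothIn.sum {ι : Type*} {t : Finset ι} {g : ι → M → F}
    (hg : ∀ a ∈ t, c.SmoothIn O (g a)) : c.SmoothIn O (fun x => ∑ a ∈ t, g a x) :=
  ContDiffOn.sum hg

theorem pd_add (hO : IsOpen O) (hs : O ⊆ c.base.source) {g h : M → F} (hg : c.SmoothIn O g)
    (hh : c.SmoothIn O h) (i : Fin n) {x : M} (hx : x ∈ O) :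
    c.pd i (fun y => g y + h y) x = c.pd i g x + c.pd i h x := by
  have hz := base_mem_chartImage hs hx
  have := (hg.differentiableAt hO hz).hasFDerivAt.add (hh.differentiableAt hO hz).hasFDerivAt
  exact congrArg (fun A : (Fin n → ℝ) →L[ℝ] F => A (Pi.single i 1)) this.fderiv

theorem pd_const (r : F) (i : Fin n) (x : M) : c.pd i (fun _ => r) x = 0 := by
  have : ((fun _ => r : M → F) ∘ c.base.symm) = fun _ => r := rfl
  simp [pd, this]

/-! ### Iterated partial derivatives -/

theorem pd_iterate_smooth (hO : IsOpen O) {g : M → F} (hg : c.SmoothIn O g) (i : Fin n) (m : ℕ) :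
    c.SmoothIn O ((c.pd i)^[m] g) := by
  induction m with
  | zero => exact hg
  | succ m ih => rw [Function.iterate_succ_apply']; exact ih.pd hO i

theorem pd_iterate_congr (hO : IsOpen O) (hs : O ⊆ c.base.source) {g h : M → F}
    (e : Set.EqOn g h O) (i : Fin n) (m : ℕ) : Set.EqOn ((c.pd i)^[m] g) ((c.pd i)^[m] h) O := by
  induction m with
  | zero => exact e
  | succ m ih => simp only [Function.iterate_succ_apply']; exact pd_congr hO hs ih i

theorem pd_iterate_comm (hO : IsOpen O) (hs : O ⊆ c.base.source) {g : M → F}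
    (hg : c.SmoothIn O g) (i j : Fin n) (m : ℕ) :
    Set.EqOn (c.pd j ((c.pd i)^[m] g)) ((c.pd i)^[m] (c.pd j g)) O := by
  induction m with
  | zero => exact fun _ _ => rfl
  | succ m ih =>
    simp only [Function.iterate_succ_apply']
    exact (pd_comm hO hs (pd_iterate_smooth hO hg i m) j i).trans (pd_congr hO hs ih i)

variable (c) in
/-- Iterated partial derivatives with respect to the variables of a list. -/
def pdList (l : List (Fin n)) (μ : Fin n → ℕ) (g : M → F) : M → F :=
  l.foldr (fun i h => (c.pd i)^[μ i] h) g

theorem pdList_smooth (hO : IsOpen O) {g : M → F} (hg : c.SmoothIn O g) (l : List (Fin n))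
    (μ : Fin n → ℕ) : c.SmoothIn O (c.pdList l μ g) := by
  induction l with
  | nil => exact hg
  | cons a l ih => exact pd_iterate_smooth hO ih a _

theorem pdList_congr (hO : IsOpen O) (hs : O ⊆ c.base.source) {g h : M → F}
    (e : Set.EqOn g h O) (l : List (Fin n)) (μ : Fin n → ℕ) :
    Set.EqOn (c.pdList l μ g) (c.pdList l μ h) O := by
  induction l with
  | nil => exact e
  | cons a l ih => exact pd_iterate_congr hO hs ih a _

theorem pdList_add_single_of_notMem {g : M → F} (l : List (Fin n)) (μ : Fin n → ℕ) (i : Fin n)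
    (hi : i ∉ l) : c.pdList l (μ + Pi.single i 1) g = c.pdList l μ g := by
  induction l with
  | nil => rfl
  | cons a l ih =>
    rw [List.mem_cons, not_or] at hi
    have : (μ + Pi.single i 1 : Fin n → ℕ) a = μ a := by simp [Ne.symm hi.1]
    change (c.pd a)^[(μ + Pi.single i 1 : Fin n → ℕ) a] (c.pdList l (μ + Pi.single i 1) g) =
      (c.pd a)^[μ a] (c.pdList l μ g)
    rw [this, ih hi.2]

/-- Induction on the list. If its head is `i`, `Nodup` keeps the tail unaffected and the power at
the head grows by one; otherwise the new `∂_i` produced in the tail commutes past the head. -/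
theorem pdList_add_single (hO : IsOpen O) (hs : O ⊆ c.base.source) {g : M → F}
    (hg : c.SmoothIn O g) (l : List (Fin n)) (hl : l.Nodup) (μ : Fin n → ℕ) (i : Fin n)
    (hi : i ∈ l) : Set.EqOn (c.pdList l (μ + Pi.single i 1) g) (c.pd i (c.pdList l μ g)) O := by
  induction l with
  | nil => simp at hi
  | cons a l ih =>
    change Set.EqOn ((c.pd a)^[(μ + Pi.single i 1 : Fin n → ℕ) a] (c.pdList l (μ + Pi.single i 1) g))
      (c.pd i ((c.pd a)^[μ a] (c.pdList l μ g))) O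
    rw [List.nodup_cons] at hl
    by_cases h : i = a
    · subst h
      rw [pdList_add_single_of_notMem l μ i hl.1]
      have : (μ + Pi.single i 1 : Fin n → ℕ) i = μ i + 1 := by simp
      rw [this, Function.iterate_succ_apply']
      exact fun _ _ => rfl
    · have hil : i ∈ l := (List.mem_cons.1 hi).resolve_left h
      have : (μ + Pi.single i 1 : Fin n → ℕ) a = μ a := by simp [Ne.symm h]
      rw [this]
      exact (pd_iterate_congr hO hs (ih hl.2 hil) a _).trans
        (pd_iterate_comm hO hs (pdList_smooth hO hg l μ) a i _).symm

theorem SmoothIn.pdMulti (hO : IsOpen O) {g : M → F} (hg : c.SmoothIn O g) (μ : Fin n → ℕ) :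
    c.SmoothIn O (c.pdMulti μ g) :=
  pdList_smooth hO hg _ μ

theorem pdMulti_congr (hO : IsOpen O) (hs : O ⊆ c.base.source) {g h : M → F}
    (e : Set.EqOn g h O) (μ : Fin n → ℕ) : Set.EqOn (c.pdMulti μ g) (c.pdMulti μ h) O :=
  pdList_congr hO hs e _ μ

theorem pdMulti_zero (g : M → F) : c.pdMulti 0 g = g := by
  simp [FibredChart.pdMulti]

theorem pdMulti_add_single (hO : IsOpen O) (hs : O ⊆ c.base.source) {g : M → F}
    (hg : c.SmoothIn O g) (μ : Fin n → ℕ) (i : Fin n) :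
    Set.EqOn (c.pdMulti (μ + Pi.single i 1) g) (c.pd i (c.pdMulti μ g)) O :=
  pdList_add_single hO hs hg _ (List.nodup_finRange n) μ i (List.mem_finRange i)

/-- Frees later arguments from the ordering of the variables in `pdMulti`: with
`pdMulti_add_single`, identities for `∂_μ` reduce to one derivative at a time. -/
theorem multiIndex_induction {P : (Fin n → ℕ) → Prop} (h0 : P 0)
    (h1 : ∀ μ i, P μ → P (μ + Pi.single i 1)) (μ : Fin n → ℕ) : P μ := by
  induction hm : ∑ i, μ i generalizing μ with
  | zero =>
    have : μ = 0 := funext fun i => Finset.sum_eq_zero_iff.1 hm i (Finset.mem_univ i)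
    exact this ▸ h0
  | succ m ih =>
    obtain ⟨i, hi⟩ : ∃ i, μ i ≠ 0 := by
      by_contra! h
      simp [h] at hm
    have e : μ - Pi.single i 1 + Pi.single i 1 = μ := by
      funext j
      by_cases hj : j = i
      · subst hj; simp; omega
      · simp [hj]
    rw [← e]
    refine h1 _ _ (ih _ ?_)
    have h2 := congrArg (fun f : Fin n → ℕ => ∑ j, f j) e
    simp only [Pi.add_apply, Finset.sum_add_distrib, Finset.sum_pi_single', Finset.mem_univ,
      if_true] at h2
    omega

theorem pdMulti_add (hO : IsOpen O) (hs : O ⊆ c.base.source) {g h : M → F}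
    (hg : c.SmoothIn O g) (hh : c.SmoothIn O h) (μ : Fin n → ℕ) : ∀ x ∈ O,
    c.pdMulti μ (fun y => g y + h y) x = c.pdMulti μ g x + c.pdMulti μ h x := by
  induction μ using multiIndex_induction with
  | h0 => simp [pdMulti_zero]
  | h1 μ i ih =>
    intro x hx
    rw [pdMulti_add_single hO hs (hg.add hh) μ i hx, pdMulti_add_single hO hs hg μ i hx,
      pdMulti_add_single hO hs hh μ i hx, pd_congr hO hs ih i hx,
      pd_add hO hs (hg.pdMulti hO μ) (hh.pdMulti hO μ) i hx]

theorem pdMulti_fun_zero (hO : IsOpen O) (hs : O ⊆ c.base.source) (μ : Fin n → ℕ) : ∀ x ∈ O,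
    c.pdMulti μ (fun _ => (0 : F)) x = 0 := by
  induction μ using multiIndex_induction with
  | h0 => simp [pdMulti_zero]
  | h1 μ i ih =>
    intro x hx
    rw [pdMulti_add_single hO hs (smoothIn_const 0) μ i hx, pd_congr hO hs ih i hx, pd_const]

theorem pdMulti_sum (hO : IsOpen O) (hs : O ⊆ c.base.source) {ι : Type*} (t : Finset ι)
    {g : ι → M → F} (hg : ∀ a, c.SmoothIn O (g a)) (μ : Fin n → ℕ) {x : M} (hx : x ∈ O) :
    c.pdMulti μ (fun y => ∑ a ∈ t, g a y) x = ∑ a ∈ t, c.pdMulti μ (g a) x := by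
  classical
  induction t using Finset.induction_on with
  | empty => simpa using pdMulti_fun_zero hO hs μ x hx
  | insert a t ha ih =>
    simp only [Finset.sum_insert ha]
    rw [pdMulti_add hO hs (hg a) (SmoothIn.sum fun a _ => hg a) μ x hx, ih]

/-- Here the extra derivative acts first instead of last, as happens when `∂_μ` is applied to a
divergence `∂_i p^{μ i}`. -/
theorem pd_pdMulti_comm (hO : IsOpen O) (hs : O ⊆ c.base.source) {g : M → F}
    (hg : c.SmoothIn O g) (i : Fin n) (μ : Fin n → ℕ) :
    Set.EqOn (c.pdMulti μ (c.pd i g)) (c.pdMulti (μ + Pi.single i 1) g) O := by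
  induction μ using multiIndex_induction with
  | h0 =>
    intro x hx
    rw [pdMulti_add_single hO hs hg 0 i hx, pdMulti_zero, pdMulti_zero]
  | h1 μ j ih =>
    intro x hx
    rw [pdMulti_add_single hO hs (hg.pd hO i) μ j hx, pd_congr hO hs ih j hx, add_right_comm,
      pdMulti_add_single hO hs hg (μ + Pi.single i 1) j hx]

end FibredChart

end ChartCalculus

/-! ### Graphs over the space of jets: tangent vectors and the Lagrangian property. -/

section GradientGraph

variable {n N k : ℕ}

/-- The components of a covector on the space of jets. -/
def covecCoord (n N l : ℕ) : (Jets n N l →L[ℝ] ℝ) →L[ℝ] Jets n N l :=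
  ContinuousLinearMap.pi fun μ => ContinuousLinearMap.pi fun K =>
    ContinuousLinearMap.apply ℝ ℝ (Pi.single μ (Pi.single K 1))

theorem covecCoord_apply {l : ℕ} (T : Jets n N l →L[ℝ] ℝ) (μ : MIdx n l) (K : Fin N) :
    covecCoord n N l T μ K = T (Pi.single μ (Pi.single K 1)) := rfl

theorem sum_covecCoord_mul {l : ℕ} (T : Jets n N l →L[ℝ] ℝ) (v : Jets n N l) :
    ∑ μ, ∑ K, covecCoord n N l T μ K * v μ K = T v := by
  have e : v = ∑ μ, ∑ K, v μ K • (Pi.single μ (Pi.single K 1) : Jets n N l) := by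
    funext ν J
    simp only [Finset.sum_apply, Pi.smul_apply, smul_eq_mul]
    rw [Finset.sum_eq_single ν, Finset.sum_eq_single J]
    · simp
    · intro K _ hK; simp [Ne.symm hK]
    · simp
    · intro μ _ hμ; simp [Ne.symm hμ]
    · simp
  conv_rhs => rw [e]
  simp only [map_sum, map_smul, smul_eq_mul, covecCoord_apply, mul_comm]

theorem covector_ext {l : ℕ} {a : Jets n N l} {T : Jets n N l →L[ℝ] ℝ}
    (h : ∀ v : Jets n N l, ∑ μ, ∑ K, a μ K * v μ K = T v) : a = covecCoord n N l T := by
  funext ν J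
  rw [covecCoord_apply, ← h, Finset.sum_eq_single ν, Finset.sum_eq_single J]
  · simp
  · intro K _ hK; simp [hK]
  · simp
  · intro μ _ hμ; simp [hμ]
  · simp

/-- The graph of `α` over `U`. -/
def graphOver {l : ℕ} (U : Set (Jets n N l)) (α : Jets n N l → Jets n N l) :
    Set (Jets n N l × Jets n N l) :=
  {a | a.1 ∈ U ∧ a.2 = α a.1}

/-- The shear `(u, j) ↦ (u, j - α u)` carries the graph to the subspace `j = 0`, and its inverse is
the shear with `+`. -/
theorem isEmbeddedSubmanifold_graphOver {l : ℕ} {U : Set (Jets n N l)} (hU : IsOpen U)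
    {α : Jets n N l → Jets n N l} (hα : ContDiffOn ℝ ∞ α U) :
    IsEmbeddedSubmanifold (graphOver U α) := by
  intro a ha
  have h1 : ContDiffOn ℝ ∞ (fun b : Jets n N l × Jets n N l => α b.1) (U ×ˢ Set.univ) :=
    hα.comp contDiffOn_fst fun b hb => hb.1
  have hs : ContDiffOn ℝ ∞ (fun b : Jets n N l × Jets n N l => (b.1, b.2 - α b.1))
      (U ×ˢ Set.univ) := contDiffOn_fst.prodMk (contDiffOn_snd.sub h1)
  have ht : ContDiffOn ℝ ∞ (fun b : Jets n N l × Jets n N l => (b.1, b.2 + α b.1))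
      (U ×ˢ Set.univ) := contDiffOn_fst.prodMk (contDiffOn_snd.add h1)
  let e : OpenPartialHomeomorph (Jets n N l × Jets n N l) (Jets n N l × Jets n N l) :=
    { toFun := fun b => (b.1, b.2 - α b.1)
      invFun := fun b => (b.1, b.2 + α b.1)
      source := U ×ˢ Set.univ
      target := U ×ˢ Set.univ
      map_source' := fun b hb => ⟨hb.1, trivial⟩
      map_target' := fun b hb => ⟨hb.1, trivial⟩
      left_inv' := fun b _ => by simp
      right_inv' := fun b _ => by simp
      open_source := hU.prod isOpen_univ
      open_target := hU.prod isOpen_univ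
      continuousOn_toFun := hs.continuousOn
      continuousOn_invFun := ht.continuousOn }
  refine ⟨e, LinearMap.ker (LinearMap.snd ℝ (Jets n N l) (Jets n N l)), ⟨ha.1, trivial⟩,
    hs, ht, fun b hb => ?_⟩
  change (b.1 ∈ U ∧ b.2 = α b.1) ↔ b.2 - α b.1 = 0
  rw [sub_eq_zero]
  exact ⟨fun h => h.2, fun h => ⟨hb.1, h⟩⟩

/-- Differentiating `γ₂ = α ∘ γ₁` gives one inclusion; for the other, the line `u + t v` is lifted
to the graph. -/
theorem tangentTo_graphOver {l : ℕ} {U : Set (Jets n N l)} (hU : IsOpen U)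
    {α : Jets n N l → Jets n N l} (hα : ContDiffOn ℝ ∞ α U) {a : Jets n N l × Jets n N l}
    (ha : a ∈ graphOver U α) :
    tangentTo (graphOver U α) a = {v | v.2 = fderiv ℝ α a.1 v.1} := by
  obtain ⟨u, j⟩ := a
  obtain ⟨hu, hj⟩ := ha
  change u ∈ U at hu
  change j = α u at hj
  subst hj
  have hαu : ContDiffAt ℝ ∞ α u := hα.contDiffAt (hU.mem_nhds hu)
  have hd : HasFDerivAt α (fderiv ℝ α u) u := (hαu.differentiableAt (by simp)).hasFDerivAt
  ext v
  constructor
  · rintro ⟨γ, hγ, h0, hS, rfl⟩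
    have hγd : HasDerivAt γ (deriv γ 0) 0 := (hγ.differentiableAt (by simp)).hasDerivAt
    have h1 : HasDerivAt (fun t => (γ t).1) (deriv γ 0).1 0 :=
      (ContinuousLinearMap.fst ℝ (Jets n N l) (Jets n N l)).hasFDerivAt.comp_hasDerivAt 0 hγd
    have h2 : HasDerivAt (fun t => (γ t).2) (deriv γ 0).2 0 :=
      (ContinuousLinearMap.snd ℝ (Jets n N l) (Jets n N l)).hasFDerivAt.comp_hasDerivAt 0 hγd
    have hd' : HasFDerivAt α (fderiv ℝ α u) (γ 0).1 := by rw [h0]; exact hd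
    have h3 : HasDerivAt (fun t => α (γ t).1) (fderiv ℝ α u (deriv γ 0).1) 0 :=
      hd'.comp_hasDerivAt 0 h1
    have h4 : (fun t => (γ t).2) =ᶠ[𝓝 0] fun t => α (γ t).1 := hS.mono fun t ht => ht.2
    exact h2.unique (h3.congr_of_eventuallyEq h4)
  · intro hv
    have hline : ContDiff ℝ ∞ fun t : ℝ => u + t • v.1 := by fun_prop
    have h0 : u + (0 : ℝ) • v.1 = u := by simp
    have hlined : HasDerivAt (fun t : ℝ => u + t • v.1) v.1 0 := by
      simpa using ((hasDerivAt_id (0 : ℝ)).smul_const v.1).const_add u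
    refine ⟨fun t => (u + t • v.1, α (u + t • v.1)), ?_, by simp, ?_, ?_⟩
    · refine hline.contDiffAt.prodMk (ContDiffAt.comp 0 ?_ hline.contDiffAt)
      rw [h0]; exact hαu
    · have : ∀ᶠ t : ℝ in 𝓝 0, u + t • v.1 ∈ U := by
        refine hline.continuous.continuousAt.eventually_mem ?_
        rw [h0]; exact hU.mem_nhds hu
      exact this.mono fun t ht => ⟨ht, rfl⟩
    · have hd' : HasFDerivAt α (fderiv ℝ α u) (u + (0 : ℝ) • v.1) := by rw [h0]; exact hd
      have := hlined.prodMk (hd'.comp_hasDerivAt 0 hlined)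
      rw [← show (v.1, fderiv ℝ α u v.1) = v from Prod.ext rfl (Eq.symm hv)]
      exact this.deriv

theorem contDiffOn_gradient {l : ℕ} {U : Set (Jets n N l)} (hU : IsOpen U)
    {f : Jets n N l → ℝ} (hf : ContDiffOn ℝ ∞ f U) :
    ContDiffOn ℝ ∞ (fun u => covecCoord n N l (fderiv ℝ f u)) U :=
  (covecCoord n N l).contDiff.comp_contDiffOn (hf.fderiv_of_isOpen hU (by simp))

/-- With `B` the Hessian, tangent vectors are `(w, B w)`, and `ω(v, (w, B w)) = ⟨v₂, w⟩ - B(v₁, w)`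
by symmetry of `B`. This vanishes for all `w` exactly when `v₂ = B v₁`, which gives isotropy and
maximality together. -/
theorem isLagrangian_graph_gradient {U : Set (Jets n N (k + 1))} (hU : IsOpen U)
    {f : Jets n N (k + 1) → ℝ} (hf : ContDiffOn ℝ ∞ f U) :
    IsLagrangian omegaI (graphOver U fun u => covecCoord n N (k + 1) (fderiv ℝ f u)) := by
  have hα := contDiffOn_gradient hU hf
  refine ⟨isEmbeddedSubmanifold_graphOver hU hα, fun a ha v => ?_⟩
  rw [tangentTo_graphOver hU hα ha]
  have hfa : ContDiffAt ℝ ∞ f a.1 := hf.contDiffAt (hU.mem_nhds ha.1)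
  have hdd : DifferentiableAt ℝ (fderiv ℝ f) a.1 :=
    ((hf.fderiv_of_isOpen hU (m := ∞) (by simp)).contDiffAt
      (hU.mem_nhds ha.1)).differentiableAt (by simp)
  have hsymm := hfa.isSymmSndFDerivAt minSmoothness_two_le_infty
  set B := fderiv ℝ (fderiv ℝ f) a.1 with hB
  have hD : fderiv ℝ (fun u => covecCoord n N (k + 1) (fderiv ℝ f u)) a.1 =
      (covecCoord n N (k + 1)).comp B :=
    ((covecCoord n N (k + 1)).hasFDerivAt.comp a.1 hdd.hasFDerivAt).fderiv
  simp only [hD, Set.mem_ofPred_eq, ContinuousLinearMap.comp_apply]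
  -- Only `w` is taken tangent; `v` stays arbitrary, as maximality requires.
  have homega : ∀ w : PhaseICoord n N k, w.2 = covecCoord n N (k + 1) (B w.1) →
      omegaI a v w = (∑ μ, ∑ K, v.2 μ K * w.1 μ K) - B v.1 w.1 := by
    intro w hw
    rw [omegaI_apply]
    simp only [Finset.sum_sub_distrib]
    rw [hw, sum_covecCoord_mul, hsymm w.1 v.1]
  constructor
  · intro hv w hw
    rw [homega w hw, hv, sum_covecCoord_mul, sub_self]
  · intro h
    refine covector_ext fun w => ?_
    have h1 := h (w, covecCoord n N (k + 1) (B w)) rfl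
    rw [homega _ rfl] at h1
    exact sub_eq_zero.1 h1

end GradientGraph

/-! ### The graph of the differential of the Lagrangian and its generating formula. -/

section Dynamics

variable {n N k : ℕ} {M Φ : Type*} [TopologicalSpace M] [ChartedSpace (Fin n → ℝ) M]
  [TopologicalSpace Φ] [ChartedSpace ((Fin n → ℝ) × (Fin N → ℝ)) Φ] {π : Φ → M}

theorem isOpen_jetDom (c : FibredChart n N π) (l : ℕ) (x : M) : IsOpen (c.jetDom l x) := by
  have : Continuous fun u : Jets n N l => (c.base x, u MIdx.zero) := by fun_prop
  exact c.tot.open_target.preimage this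

theorem LagrangianDensity.contDiffOn_fib {l : ℕ} (𝓛 : LagrangianDensity n N π l)
    (c : FibredChart n N π) (x : M) : ContDiffOn ℝ ∞ (𝓛.fib c x) (c.jetDom l x) := by
  have : ContDiff ℝ ∞ fun u : Jets n N l => (c.base x, u) := by fun_prop
  exact (𝓛.smooth c).comp this.contDiffOn fun u hu => hu

variable [NeZero n]

theorem mem_dynamics_iff (𝓛 : LagrangianDensity n N π (k + 1)) (c : FibredChart n N π) (x : M)
    (a : PhaseI (c.jetDom (k + 1) x)) : a ∈ dynamics 𝓛 c x ↔
      (PhaseI.coord _ a).1.2 = covecCoord n N (k + 1) (fderiv ℝ (𝓛.fib c x) (PhaseI.coord _ a).1.1) :=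
  ⟨fun h => covector_ext h, fun h v => by rw [h, sum_covecCoord_mul]⟩

theorem coordImage_dynamics (𝓛 : LagrangianDensity n N π (k + 1)) (c : FibredChart n N π) (x : M) :
    coordImage (dynamics 𝓛 c x) = graphOver (c.jetDom (k + 1) x)
      fun u => covecCoord n N (k + 1) (fderiv ℝ (𝓛.fib c x) u) := by
  ext a
  constructor
  · rintro ⟨b, hb, rfl⟩
    exact ⟨(PhaseI.coord _ b).2, (mem_dynamics_iff 𝓛 c x b).1 hb⟩
  · rintro ⟨h1, h2⟩
    refine ⟨(PhaseI.coord _).symm ⟨a, h1⟩, ?_, by simp⟩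
    rw [mem_dynamics_iff]
    simpa using h2

theorem coordImage_injective (U : Set (Jets n N (k + 1))) :
    Function.Injective (coordImage : Set (PhaseI U) → Set (PhaseICoord n N k)) :=
  Set.image_injective.2 (Subtype.val_injective.comp (PhaseI.coord U).injective)

theorem isSmoothSectionImage_dynamics (𝓛 : LagrangianDensity n N π (k + 1))
    (c : FibredChart n N π) (x : M) : IsSmoothSectionImage (dynamics 𝓛 c x) :=
  ⟨_, contDiffOn_gradient (isOpen_jetDom c _ x) (𝓛.contDiffOn_fib c x), coordImage_dynamics 𝓛 c x⟩

theorem isLagrangian_dynamics (𝓛 : LagrangianDensity n N π (k + 1))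
    (c : FibredChart n N π) (x : M) : IsLagrangian omegaI (coordImage (dynamics 𝓛 c x)) := by
  rw [coordImage_dynamics]
  exact isLagrangian_graph_gradient (isOpen_jetDom c _ x) (𝓛.contDiffOn_fib c x)

/-- Tangent vectors of a section's image project onto all jet vectors `v`, and `thetaI` depends on
its vector argument only through that projection. The formula thus fixes the section as a covector
at each jet. -/
theorem generatingFormula_iff (𝓛 : LagrangianDensity n N π (k + 1)) (c : FibredChart n N π)
    (x : M) (S : Set (PhaseI (c.jetDom (k + 1) x))) (hS : IsSmoothSectionImage S) :
    GeneratingFormula 𝓛 c x S ↔ S = dynamics 𝓛 c x := by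
  constructor
  · intro h
    obtain ⟨α, hα, hSα⟩ := hS
    change coordImage S = graphOver _ α at hSα
    apply coordImage_injective
    rw [coordImage_dynamics, hSα]
    have key : ∀ u ∈ c.jetDom (k + 1) x,
        α u = covecCoord n N (k + 1) (fderiv ℝ (𝓛.fib c x) u) := by
      intro u hu
      refine covector_ext fun v => ?_
      have hmem : (u, α u) ∈ graphOver (c.jetDom (k + 1) x) α := ⟨hu, rfl⟩
      have := h (u, α u) (by rw [hSα]; exact hmem) (v, fderiv ℝ α u v) (by
        rw [hSα, tangentTo_graphOver (isOpen_jetDom c _ x) hα hmem]; rfl)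
      exact this
    ext a
    exact and_congr_right fun ha => by rw [key _ ha]
  -- On `dynamics` the two forms agree on every vector, tangent or not.
  · rintro rfl a ⟨b, hb, rfl⟩ v _
    exact hb v.1

end Dynamics

/-! ### Arithmetic of multi-indices. -/

theorem sum_add_single {n : ℕ} (ν : Fin n → ℕ) (i : Fin n) :
    ∑ j, (ν + Pi.single i 1 : Fin n → ℕ) j = ∑ j, ν j + 1 := by
  simp [Finset.sum_add_distrib]

theorem sub_single_add_single {n : ℕ} {μ : Fin n → ℕ} {i : Fin n} (hi : μ i ≠ 0) :
    μ - Pi.single i 1 + Pi.single i 1 = μ := by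
  funext j
  by_cases hj : j = i
  · subst hj; simp; omega
  · simp [hj]

theorem MIdx.exists_succ_eq {n l : ℕ} (μ : MIdx n (l + 1)) (i : Fin n) (hi : μ.1 i ≠ 0) :
    ∃ ν : MIdx n l, ν.succ i = μ := by
  have e := sub_single_add_single hi
  have h := sum_add_single (μ.1 - Pi.single i 1) i
  rw [e] at h
  have := μ.2
  exact ⟨⟨μ.1 - Pi.single i 1, by omega⟩, Subtype.ext e⟩

theorem MIdx.succ_left_injective {n l : ℕ} (i : Fin n) :
    Function.Injective fun ν : MIdx n l => ν.succ i := by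
  intro a b h
  exact Subtype.ext (add_right_cancel (congrArg Subtype.val h))

/-- A multi-index is either of length at most `l` or of the form `ν + e_i`. Hence a holonomic first
jet of the phase bundle comes from only one jet of the next order. -/
theorem Jets.ext_trunc_shift {n N l : ℕ} {u v : Jets n N (l + 1)} (h : trunc u = trunc v)
    (h' : ∀ i, shift i u = shift i v) : u = v := by
  funext μ
  by_cases hμ : ∑ i, μ.1 i ≤ l
  · exact congrFun h ⟨μ.1, hμ⟩
  · obtain ⟨i, hi⟩ : ∃ i, μ.1 i ≠ 0 := by
      by_contra! hc
      simp [hc] at hμ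
    obtain ⟨ν, rfl⟩ := μ.exists_succ_eq i hi
    exact congrFun (h' i) ν

/-! ### Sections and their prolongations, and the Euler operator on currents. -/

section Sections

variable {n N k : ℕ} {M Φ : Type*} [TopologicalSpace M] [ChartedSpace (Fin n → ℝ) M]
  [TopologicalSpace Φ] [ChartedSpace ((Fin n → ℝ) × (Fin N → ℝ)) Φ] {π : Φ → M}
  {c : FibredChart n N π} {O : Set M}

namespace FibredChart

theorem SmoothIn.apply {ι : Type*} [Fintype ι] {E : ι → Type*} [∀ i, NormedAddCommGroup (E i)]
    [∀ i, NormedSpace ℝ (E i)] {g : M → ∀ i, E i} (hg : c.SmoothIn O g) (a : ι) :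
    c.SmoothIn O (fun x => g x a) :=
  smoothIn_pi.1 hg a

theorem pd_apply (hO : IsOpen O) (hs : O ⊆ c.base.source) {ι : Type*} [Fintype ι]
    {E : ι → Type*} [∀ i, NormedAddCommGroup (E i)] [∀ i, NormedSpace ℝ (E i)]
    {g : M → ∀ i, E i} (hg : c.SmoothIn O g) (i : Fin n) (a : ι) {x : M} (hx : x ∈ O) :
    c.pd i g x a = c.pd i (fun y => g y a) x :=
  (pd_clm hO hs hg (ContinuousLinearMap.proj (R := ℝ) a) i hx).symm

theorem smoothIn_of_contMDiffOn [IsManifold 𝓘(ℝ, Fin n → ℝ) ∞ M] {F : Type*}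
    [NormedAddCommGroup F] [NormedSpace ℝ F] {g : M → F}
    (hg : ContMDiffOn 𝓘(ℝ, Fin n → ℝ) 𝓘(ℝ, F) ∞ g O) : c.SmoothIn O g := by
  rw [SmoothIn, ← contMDiffOn_iff_contDiffOn]
  exact hg.comp ((contMDiffOn_symm_of_mem_maximalAtlas c.base_mem).mono fun z hz => hz.1)
    fun z hz => hz.2

theorem SmoothIn.contMDiffOn [IsManifold 𝓘(ℝ, Fin n → ℝ) ∞ M] (hs : O ⊆ c.base.source)
    {F : Type*} [NormedAddCommGroup F] [NormedSpace ℝ F] {g : M → F} (hg : c.SmoothIn O g) :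
    ContMDiffOn 𝓘(ℝ, Fin n → ℝ) 𝓘(ℝ, F) ∞ g O := by
  rw [SmoothIn, ← contMDiffOn_iff_contDiffOn] at hg
  refine (hg.comp ((contMDiffOn_of_mem_maximalAtlas c.base_mem).mono hs)
    fun x hx => base_mem_chartImage hs hx).congr fun x hx => ?_
  simp [c.base.left_inv (hs hx)]

theorem smoothIn_section [IsManifold 𝓘(ℝ, Fin n → ℝ) ∞ M]
    [IsManifold 𝓘(ℝ, (Fin n → ℝ) × (Fin N → ℝ)) ∞ Φ] {s : M → Φ} (h : IsSectionOn n N π O s)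
    (hm : Set.MapsTo s O c.tot.source) : c.SmoothIn O (fun y => (c.tot (s y)).2) := by
  have h1 : ContMDiffOn 𝓘(ℝ, Fin n → ℝ) 𝓘(ℝ, (Fin n → ℝ) × (Fin N → ℝ)) ∞
      (fun y => c.tot (s y)) O :=
    (contMDiffOn_of_mem_maximalAtlas c.tot_mem).comp h.1 hm
  exact (smoothIn_of_contMDiffOn h1).clm (ContinuousLinearMap.snd ℝ (Fin n → ℝ) (Fin N → ℝ))

theorem tot_section {s : M → Φ} (h : IsSectionOn n N π O s)
    (hm : Set.MapsTo s O c.tot.source) {x : M} (hx : x ∈ O) :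
    (c.base x, (c.tot (s x)).2) ∈ c.tot.target := by
  have : (c.base x, (c.tot (s x)).2) = c.tot (s x) :=
    Prod.ext (by rw [c.proj_eq _ (hm hx), h.2 x hx]) rfl
  rw [this]
  exact c.tot.map_source (hm hx)

theorem exists_section [IsManifold 𝓘(ℝ, Fin n → ℝ) ∞ M]
    [IsManifold 𝓘(ℝ, (Fin n → ℝ) × (Fin N → ℝ)) ∞ Φ] (hs : O ⊆ c.base.source)
    {f : M → Fin N → ℝ} (hf : c.SmoothIn O f) (ht : ∀ x ∈ O, (c.base x, f x) ∈ c.tot.target) :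
    ∃ s : M → Φ, IsSectionOn n N π O s ∧ Set.MapsTo s O c.tot.source ∧
      ∀ x ∈ O, (c.tot (s x)).2 = f x := by
  have hm : Set.MapsTo (fun x => c.tot.symm (c.base x, f x)) O c.tot.source :=
    fun x hx => c.tot.map_target (ht x hx)
  refine ⟨fun x => c.tot.symm (c.base x, f x), ⟨?_, fun x hx => ?_⟩, hm, fun x hx => ?_⟩
  · have h1 : ContMDiffOn 𝓘(ℝ, Fin n → ℝ) 𝓘(ℝ, (Fin n → ℝ) × (Fin N → ℝ)) ∞
        (fun x => (c.base x, f x)) O :=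
      ((contMDiffOn_of_mem_maximalAtlas c.base_mem).mono hs).prodMk_space (hf.contMDiffOn hs)
    exact (contMDiffOn_symm_of_mem_maximalAtlas c.tot_mem).comp h1 ht
  -- The two points of `M` have equal coordinates in `c.base`, since the base part of `c.tot` is
  -- `c.base ∘ π`.
  · refine c.base.injOn (c.proj_mem _ (hm hx)) (hs hx) ?_
    rw [← c.proj_eq _ (hm hx), c.tot.right_inv (ht x hx)]
  · simp only [c.tot.right_inv (ht x hx)]

theorem smoothIn_prolong (hO : IsOpen O) {s : M → Φ}
    (h : c.SmoothIn O (fun y => (c.tot (s y)).2)) (l : ℕ) : c.SmoothIn O (c.prolong l s) :=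
  smoothIn_pi.2 fun μ => smoothIn_pi.2 fun K => (h.apply K).pdMulti hO μ.1

theorem prolong_apply_zero (l : ℕ) (s : M → Φ) (x : M) :
    c.prolong l s x MIdx.zero = (c.tot (s x)).2 := by
  funext K
  exact congrFun (pdMulti_zero _) x

theorem shift_prolong (hO : IsOpen O) (hs : O ⊆ c.base.source) {s : M → Φ}
    (h : c.SmoothIn O (fun y => (c.tot (s y)).2)) (l : ℕ) (i : Fin n) {x : M} (hx : x ∈ O) :
    shift i (c.prolong (l + 1) s x) = c.pd i (c.prolong l s) x := by
  funext ν K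
  have hp := smoothIn_prolong hO h l
  rw [pd_apply hO hs hp i ν hx, pd_apply hO hs (hp.apply ν) i K hx]
  exact pdMulti_add_single hO hs (h.apply K) ν.1 i hx

end FibredChart

open FibredChart

/-- The fibre derivative of `L` is its total derivative on a vertical vector `(0, e)`. It is
therefore smooth jointly in base point and jet, and can be composed with the prolongation. -/
theorem LagrangianDensity.smoothIn_dL {l : ℕ} (𝓛 : LagrangianDensity n N π l) (hO : IsOpen O)
    {s : M → Φ} (h : c.SmoothIn O (fun y => (c.tot (s y)).2))
    (ht : ∀ x ∈ O, (c.base x, (c.tot (s x)).2) ∈ c.tot.target) (μ : MIdx n l) (K : Fin N) :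
    c.SmoothIn O (fun y => 𝓛.dL c y (c.prolong l s y) μ K) := by
  set W : Set ((Fin n → ℝ) × Jets n N l) := {a | (a.1, a.2 MIdx.zero) ∈ c.tot.target} with hW
  have hWo : IsOpen W := by
    have : Continuous fun a : (Fin n → ℝ) × Jets n N l => (a.1, a.2 MIdx.zero) := by fun_prop
    exact c.tot.open_target.preimage this
  have h1 : ContDiffOn ℝ ∞ (fderiv ℝ (coordRep 𝓛.toFun c)) W :=
    (𝓛.smooth c).fderiv_of_isOpen hWo (by simp)
  have h2 : ContDiffOn ℝ ∞ (fun z => (z, (c.prolong l s ∘ c.base.symm) z)) (c.chartImage O) :=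
    contDiffOn_id.prodMk (smoothIn_prolong hO h l)
  have hmaps : Set.MapsTo (fun z => (z, (c.prolong l s ∘ c.base.symm) z)) (c.chartImage O) W := by
    intro z hz
    have := ht _ hz.2
    rw [c.base.right_inv hz.1] at this
    change (z, c.prolong l s (c.base.symm z) MIdx.zero) ∈ c.tot.target
    rwa [prolong_apply_zero]
  have h3 := (h1.comp h2 hmaps).clm_apply
    (contDiffOn_const (c := ((0, Pi.single μ (Pi.single K 1)) : (Fin n → ℝ) × Jets n N l)))
  refine ContDiffOn.congr h3 fun z hz => ?_
  have hd : HasFDerivAt (coordRep 𝓛.toFun c) _ (z, c.prolong l s (c.base.symm z)) :=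
    (((𝓛.smooth c).contDiffAt (hWo.mem_nhds (hmaps hz))).differentiableAt (by simp)).hasFDerivAt
  have hi := hd.comp (c.prolong l s (c.base.symm z))
    (hasFDerivAt_prodMk_right z (c.prolong l s (c.base.symm z)))
  have he : 𝓛.fib c (c.base.symm z) = coordRep 𝓛.toFun c ∘ fun u => (z, u) := by
    funext u
    simp [LagrangianDensity.fib, c.base.right_inv hz.1]
  simp only [Function.comp_apply, LagrangianDensity.dL, he, hi.fderiv]
  rfl

theorem divPart_pd (hO : IsOpen O) (hs : O ⊆ c.base.source) {ρ : M → Mom n N k}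
    (hρ : c.SmoothIn O ρ) (μ : MIdx n (k + 1)) (K : Fin N) {x : M} (hx : x ∈ O) :
    divPart (fun i => c.pd i ρ x) μ K =
      if h : ∑ i, μ.1 i ≤ k then ∑ i, c.pd i (fun y => ρ y ⟨μ.1, h⟩ K i) x else 0 := by
  unfold divPart
  refine dite_congr rfl (fun h => Finset.sum_congr rfl fun i _ => ?_) fun _ => rfl
  change c.pd i ρ x _ K i = _
  rw [pd_apply hO hs hρ i _ hx, pd_apply hO hs (hρ.apply _) i _ hx,
    pd_apply hO hs ((hρ.apply _).apply _) i _ hx]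

theorem smoothIn_symPart {ρ : M → Mom n N k} (hρ : c.SmoothIn O ρ) (μ : MIdx n (k + 1))
    (K : Fin N) : c.SmoothIn O (fun y => symPart (ρ y) μ K) := by
  refine SmoothIn.sum fun ν _ => SmoothIn.sum fun i _ => ?_
  by_cases h : ν.succ i = μ
  · simp only [h, if_true]; exact ((hρ.apply ν).apply K).apply i
  · simp only [h, if_false]; exact smoothIn_const 0

theorem smoothIn_divPart (hO : IsOpen O) (hs : O ⊆ c.base.source) {ρ : M → Mom n N k}
    (hρ : c.SmoothIn O ρ) (μ : MIdx n (k + 1)) (K : Fin N) :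
    c.SmoothIn O (fun y => divPart (fun i => c.pd i ρ y) μ K) := by
  refine SmoothIn.congr ?_ fun y hy => divPart_pd hO hs hρ μ K hy
  by_cases h : ∑ i, μ.1 i ≤ k
  · simp only [h, dite_true]
    exact SmoothIn.sum fun i _ => (((hρ.apply _).apply K).apply i).pd hO i
  · simp only [h, dite_false]; exact smoothIn_const 0

/-- This and `pdMulti_divPart` are both expressed through the terms `∂_{ν+e_i} p^{ν i}`, so that
they can be cancelled against each other. -/
theorem pdMulti_symPart (hO : IsOpen O) (hs : O ⊆ c.base.source) {ρ : M → Mom n N k}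
    (hρ : c.SmoothIn O ρ) (μ : MIdx n (k + 1)) (K : Fin N) {x : M} (hx : x ∈ O) :
    c.pdMulti μ.1 (fun y => symPart (ρ y) μ K) x = ∑ ν : MIdx n k, ∑ i : Fin n,
      if ν.succ i = μ then c.pdMulti (ν.1 + Pi.single i 1) (fun y => ρ y ν K i) x else 0 := by
  have hsm : ∀ (ν : MIdx n k) (i : Fin n),
      c.SmoothIn O (fun y => if ν.succ i = μ then ρ y ν K i else 0) := by
    intro ν i
    by_cases h : ν.succ i = μ
    · simp only [h, if_true]; exact ((hρ.apply ν).apply K).apply i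
    · simp only [h, if_false]; exact smoothIn_const 0
  unfold symPart
  rw [pdMulti_sum hO hs _ (fun ν => SmoothIn.sum fun i _ => hsm ν i) _ hx]
  refine Finset.sum_congr rfl fun ν _ => ?_
  rw [pdMulti_sum hO hs _ (hsm ν) _ hx]
  refine Finset.sum_congr rfl fun i _ => ?_
  by_cases h : ν.succ i = μ
  · subst h; simp only [if_true]; rfl
  · simp only [h, if_false]; exact pdMulti_fun_zero hO hs _ x hx

theorem pdMulti_divPart (hO : IsOpen O) (hs : O ⊆ c.base.source) {ρ : M → Mom n N k}
    (hρ : c.SmoothIn O ρ) (μ : MIdx n (k + 1)) (K : Fin N) {x : M} (hx : x ∈ O) :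
    c.pdMulti μ.1 (fun y => divPart (fun i => c.pd i ρ y) μ K) x = ∑ ν : MIdx n k,
      if ν.incl = μ then
        ∑ i : Fin n, c.pdMulti (ν.1 + Pi.single i 1) (fun y => ρ y ν K i) x else 0 := by
  rw [pdMulti_congr hO hs (fun y hy => divPart_pd hO hs hρ μ K hy) μ.1 hx]
  by_cases h : ∑ i, μ.1 i ≤ k
  · simp only [h, dite_true]
    rw [Finset.sum_eq_single (⟨μ.1, h⟩ : MIdx n k)]
    · rw [if_pos (by rfl), pdMulti_sum hO hs _
        (fun i => (((hρ.apply _).apply K).apply i).pd hO i) _ hx]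
      exact Finset.sum_congr rfl fun i _ =>
        pd_pdMulti_comm hO hs (((hρ.apply _).apply K).apply i) i _ hx
    · intro ν _ hν
      exact if_neg fun e => hν (Subtype.ext (congrArg (fun b : MIdx n (k + 1) => b.1) e))
    · simp
  · simp only [h, dite_false]
    rw [pdMulti_fun_zero hO hs _ x hx]
    refine (Finset.sum_eq_zero fun ν _ => if_neg fun e => h ?_).symm
    rw [← e]
    exact ν.2

/-- The Euler operator annihilates currents `p^{(μ)} + ∂_i p^{μ i}`. -/
theorem sum_pdMulti_current (hO : IsOpen O) (hs : O ⊆ c.base.source) {ρ : M → Mom n N k}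
    (hρ : c.SmoothIn O ρ) (K : Fin N) {x : M} (hx : x ∈ O) :
    ∑ μ : MIdx n (k + 1), (-1 : ℝ) ^ (∑ i, μ.1 i) * c.pdMulti μ.1
      (fun y => symPart (ρ y) μ K + divPart (fun i => c.pd i ρ y) μ K) x = 0 := by
  have e : ∀ μ : MIdx n (k + 1), (-1 : ℝ) ^ (∑ i, μ.1 i) * c.pdMulti μ.1
      (fun y => symPart (ρ y) μ K + divPart (fun i => c.pd i ρ y) μ K) x =
      (∑ ν : MIdx n k, ∑ i : Fin n, if ν.succ i = μ then (-1 : ℝ) ^ (∑ i, μ.1 i) *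
        c.pdMulti (ν.1 + Pi.single i 1) (fun y => ρ y ν K i) x else 0) +
      ∑ ν : MIdx n k, if ν.incl = μ then (-1 : ℝ) ^ (∑ i, μ.1 i) *
        ∑ i : Fin n, c.pdMulti (ν.1 + Pi.single i 1) (fun y => ρ y ν K i) x else 0 := by
    intro μ
    rw [pdMulti_add hO hs (smoothIn_symPart hρ μ K) (smoothIn_divPart hO hs hρ μ K) _ x hx,
      pdMulti_symPart hO hs hρ μ K hx, pdMulti_divPart hO hs hρ μ K hx, mul_add]
    simp only [Finset.mul_sum, mul_ite, mul_zero]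
  simp only [e, Finset.sum_add_distrib]
  -- Summing over `μ` first leaves one term for each `(ν, i)`, with sign `(-1)^{|ν|+1}` here and
  -- `(-1)^{|ν|}` in `e2`.
  have e1 : ∑ μ : MIdx n (k + 1), ∑ ν : MIdx n k, ∑ i : Fin n, (if ν.succ i = μ then
      (-1 : ℝ) ^ (∑ i, μ.1 i) * c.pdMulti (ν.1 + Pi.single i 1) (fun y => ρ y ν K i) x else 0) =
      ∑ ν : MIdx n k, ∑ i : Fin n, (-1 : ℝ) ^ (∑ i, ν.1 i + 1) *
        c.pdMulti (ν.1 + Pi.single i 1) (fun y => ρ y ν K i) x := by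
    rw [Finset.sum_comm]
    refine Finset.sum_congr rfl fun ν _ => ?_
    rw [Finset.sum_comm]
    refine Finset.sum_congr rfl fun i _ => ?_
    rw [Finset.sum_ite_eq, if_pos (Finset.mem_univ _)]
    congr 2
    exact sum_add_single ν.1 i
  have e2 : ∑ μ : MIdx n (k + 1), ∑ ν : MIdx n k, (if ν.incl = μ then
      (-1 : ℝ) ^ (∑ i, μ.1 i) *
        ∑ i : Fin n, c.pdMulti (ν.1 + Pi.single i 1) (fun y => ρ y ν K i) x else 0) =
      ∑ ν : MIdx n k, (-1 : ℝ) ^ (∑ i, ν.1 i) * ∑ i : Fin n,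
        c.pdMulti (ν.1 + Pi.single i 1) (fun y => ρ y ν K i) x := by
    rw [Finset.sum_comm]
    refine Finset.sum_congr rfl fun ν _ => ?_
    rw [Finset.sum_ite_eq, if_pos (Finset.mem_univ _)]
    rfl
  rw [e1, e2, ← Finset.sum_add_distrib]
  refine Finset.sum_eq_zero fun ν _ => ?_
  rw [Finset.mul_sum, ← Finset.sum_add_distrib]
  refine Finset.sum_eq_zero fun i _ => ?_
  rw [pow_succ]; ring

/-- If the momentum equations hold for `μ ≠ 0`, the Euler–Lagrange expression is the defect of the
momentum equation for `μ = 0`. -/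
theorem eulerLagrange_sum_eq (𝓛 : LagrangianDensity n N π (k + 1)) (hO : IsOpen O)
    (hs : O ⊆ c.base.source) {s : M → Φ}
    {σ : M → Jets n N k × Mom n N k} (hσ : c.SmoothIn O (fun y => (σ y).2))
    (hm : ∀ x ∈ O, ∀ μ, 1 ≤ ∑ i, μ.1 i → MomentumEq 𝓛 c s σ x μ) (K : Fin N) {x : M}
    (hx : x ∈ O) :
    ∑ μ : MIdx n (k + 1), (-1 : ℝ) ^ (∑ i, μ.1 i) *
      c.pdMulti μ.1 (fun y => 𝓛.dL c y (c.prolong (k + 1) s y) μ K) x =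
    𝓛.dL c x (c.prolong (k + 1) s x) MIdx.zero K - (symPart (σ x).2 MIdx.zero K +
      divPart (fun i => c.pd i (fun y => (σ y).2) x) MIdx.zero K) := by
  -- The subtracted zero is rewritten as the Euler operator applied to the current; the two sums
  -- then agree term by term except at `μ = 0`.
  rw [← sub_zero (∑ μ : MIdx n (k + 1), _), ← sum_pdMulti_current hO hs hσ K hx,
    ← Finset.sum_sub_distrib, Finset.sum_eq_single MIdx.zero]
  · have e : ∀ g : M → ℝ, c.pdMulti (MIdx.zero : MIdx n (k + 1)).1 g x = g x :=
      fun g => congrFun (pdMulti_zero g) x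
    rw [e, e]
    simp [MIdx.zero]
  · intro μ _ hμ
    have h1 : 1 ≤ ∑ i, μ.1 i := by
      by_contra! hc
      refine hμ (Subtype.ext (funext fun i => ?_))
      exact Finset.sum_eq_zero_iff.1 (Nat.lt_one_iff.1 hc) i (Finset.mem_univ i)
    rw [sub_eq_zero]
    congr 1
    refine pdMulti_congr hO hs (fun y hy => ?_) μ.1 hx
    simp only [hm y hy μ h1 K, sub_add_cancel]
  · simp

/-- The equivalence is stated over all of `O` and not pointwise, because derivatives of the momentum
equations enter. -/
theorem momentumEq_iff_eulerLagrange (𝓛 : LagrangianDensity n N π (k + 1)) (hO : IsOpen O)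
    (hs : O ⊆ c.base.source) {s : M → Φ}
    {σ : M → Jets n N k × Mom n N k} (hσ : c.SmoothIn O (fun y => (σ y).2)) :
    (∀ x ∈ O, ∀ μ, MomentumEq 𝓛 c s σ x μ) ↔
      ∀ x ∈ O, (∀ μ, 1 ≤ ∑ i, μ.1 i → MomentumEq 𝓛 c s σ x μ) ∧ EulerLagrangeAt 𝓛 c s x := by
  constructor
  · intro hm x hx
    refine ⟨fun μ _ => hm x hx μ, fun K => ?_⟩
    rw [eulerLagrange_sum_eq 𝓛 hO hs hσ (fun x hx μ _ => hm x hx μ) K hx,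
      hm x hx MIdx.zero K]
    ring
  · intro hm x hx μ
    by_cases h1 : 1 ≤ ∑ i, μ.1 i
    · exact (hm x hx).1 μ h1
    · have hμ : μ = MIdx.zero := Subtype.ext (funext fun i =>
        Finset.sum_eq_zero_iff.1 (Nat.lt_one_iff.1 (not_le.1 h1)) i (Finset.mem_univ i))
      subst hμ
      intro K
      have := (hm x hx).2 K
      rw [eulerLagrange_sum_eq 𝓛 hO hs hσ (fun x hx μ => (hm x hx).1 μ) K hx] at this
      linarith

end Sections

/-! ### The first-order equation: holonomy and momentum equations. -/

section Equation

variable {n N k : ℕ} [NeZero n] {M Φ : Type*} [TopologicalSpace M] [ChartedSpace (Fin n → ℝ) M]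
  [TopologicalSpace Φ] [ChartedSpace ((Fin n → ℝ) × (Fin N → ℝ)) Φ] {π : Φ → M}
  {c : FibredChart n N π} {O : Set M}

open FibredChart

/-- Splits the equation into holonomy, with `u` the jet of order `k + 1`, and equality of the
current with the gradient of `L` at `u`. -/
theorem solvesAt_iff (𝓛 : LagrangianDensity n N π (k + 1)) (hO : IsOpen O)
    (hs : O ⊆ c.base.source) {σ : M → Jets n N k × Mom n N k} (hσ : c.SmoothIn O σ) {x : M}
    (hx : x ∈ O) (hd : (σ x).1 ∈ c.jetDom k x) : SolvesAt 𝓛 c σ x ↔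
      ∃ u : Jets n N (k + 1), trunc u = (σ x).1 ∧
        (∀ i, shift i u = c.pd i (fun y => (σ y).1) x) ∧
        ∀ μ K, symPart (σ x).2 μ K =
          𝓛.dL c x u μ K - divPart (fun i => c.pd i (fun y => (σ y).2) x) μ K := by
  have e1 : ∀ i, c.pd i (fun y => (σ y).1) x = (c.pd i σ x).1 := fun i =>
    pd_clm hO hs hσ (ContinuousLinearMap.fst ℝ _ _) i hx
  have e2 : ∀ i, c.pd i (fun y => (σ y).2) x = (c.pd i σ x).2 := fun i =>
    pd_clm hO hs hσ (ContinuousLinearMap.snd ℝ _ _) i hx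
  simp only [e1, e2]
  constructor
  · rintro ⟨⟨⟨u, p, q⟩, hu⟩, hη, hD⟩
    have h1 : trunc u = (σ x).1 := congrArg (fun ζ : JetPhase n N k => ζ.1.1) hη
    have h2 : p = (σ x).2 := congrArg (fun ζ : JetPhase n N k => ζ.1.2) hη
    have h3 : ∀ i, shift i u = (c.pd i σ x).1 := fun i =>
      congrArg (fun ζ : JetPhase n N k => (ζ.2 i).1) hη
    have h4 : q = fun i => (c.pd i σ x).2 := funext fun i =>
      congrArg (fun ζ : JetPhase n N k => (ζ.2 i).2) hη
    refine ⟨u, h1, h3, fun μ K => ?_⟩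
    have h5 : current (u, p, q) = covecCoord n N (k + 1) (fderiv ℝ (𝓛.fib c x) u) :=
      (mem_dynamics_iff 𝓛 c x _).1 hD
    have h6 := congrFun (congrFun h5 μ) K
    rw [covecCoord_apply] at h6
    rw [← h2, ← h4]
    exact eq_sub_of_add_eq h6
  · rintro ⟨u, h1, h2, h3⟩
    have hu : u ∈ c.jetDom (k + 1) x := by
      have : (trunc u) ∈ c.jetDom k x := h1 ▸ hd
      -- The chart domain constrains only the component of index `0`, which `trunc` preserves.
      exact this
    refine ⟨⟨(u, (σ x).2, fun i => (c.pd i σ x).2), hu⟩, ?_, ?_⟩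
    · refine Prod.ext (Prod.ext h1 rfl) (funext fun i => Prod.ext (h2 i) rfl)
    · refine (mem_dynamics_iff 𝓛 c x _).2 ?_
      change current (u, (σ x).2, fun i => (c.pd i σ x).2) =
        covecCoord n N (k + 1) (fderiv ℝ (𝓛.fib c x) u)
      funext μ K
      rw [covecCoord_apply]
      exact add_eq_of_eq_sub (h3 μ K)

/-- Over a prolonged section, `Jets.ext_trunc_shift` leaves the next prolongation as the only
candidate for `u`. -/
theorem solvesAt_iff_momentumEq (𝓛 : LagrangianDensity n N π (k + 1)) (hO : IsOpen O)
    (hs : O ⊆ c.base.source) {σ : M → Jets n N k × Mom n N k} (hσ : c.SmoothIn O σ)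
    (hd : ∀ x ∈ O, (σ x).1 ∈ c.jetDom k x) {s : M → Φ}
    (h : c.SmoothIn O (fun y => (c.tot (s y)).2)) (hp : ∀ x ∈ O, (σ x).1 = c.prolong k s x)
    {x : M} (hx : x ∈ O) : SolvesAt 𝓛 c σ x ↔ ∀ μ, MomentumEq 𝓛 c s σ x μ := by
  rw [solvesAt_iff 𝓛 hO hs hσ hx (hd x hx)]
  have e : ∀ i, c.pd i (fun y => (σ y).1) x = shift i (c.prolong (k + 1) s x) := fun i => by
    rw [shift_prolong hO hs h k i hx]
    exact pd_congr hO hs hp i hx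
  simp only [e, hp x hx]
  constructor
  · rintro ⟨u, h1, h2, h3⟩
    have : u = c.prolong (k + 1) s x := Jets.ext_trunc_shift h1 h2
    subst this
    exact h3
  · exact fun hm => ⟨c.prolong (k + 1) s x, rfl, fun _ => rfl, hm⟩

theorem eq_pdMulti_of_solvesAt (𝓛 : LagrangianDensity n N π (k + 1)) (hO : IsOpen O)
    (hs : O ⊆ c.base.source) {σ : M → Jets n N k × Mom n N k} (hσ : c.SmoothIn O σ)
    (hd : ∀ x ∈ O, (σ x).1 ∈ c.jetDom k x) (hD : ∀ x ∈ O, SolvesAt 𝓛 c σ x) (K : Fin N)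
    (μ : Fin n → ℕ) : ∀ hμ : ∑ i, μ i ≤ k, ∀ x ∈ O,
      (σ x).1 ⟨μ, hμ⟩ K = c.pdMulti μ (fun y => (σ y).1 MIdx.zero K) x := by
  have h1 : c.SmoothIn O fun y => (σ y).1 := hσ.clm (ContinuousLinearMap.fst ℝ _ _)
  have h0 : c.SmoothIn O fun y => (σ y).1 MIdx.zero K := (h1.apply _).apply K
  induction μ using multiIndex_induction with
  | h0 => intro hμ x _; rw [pdMulti_zero]; rfl
  | h1 μ i ih =>
    intro hμ x hx
    have hμ' : ∑ i, μ i ≤ k := by rw [sum_add_single] at hμ; omega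
    obtain ⟨u, e1, e2, -⟩ := (solvesAt_iff 𝓛 hO hs hσ hx (hd x hx)).1 (hD x hx)
    -- `u_{μ+e_i}` is read once through `trunc` and once through `shift i`; comparing the two gives
    -- `φ_{μ+e_i} = ∂_i φ_μ`.
    have e3 : (σ x).1 ⟨μ + Pi.single i 1, hμ⟩ K = shift i u ⟨μ, hμ'⟩ K := by
      rw [← e1]; rfl
    rw [e3, e2, pdMulti_add_single hO hs h0 μ i hx, pd_apply hO hs h1 i _ hx,
      pd_apply hO hs (h1.apply _) i _ hx]
    exact pd_congr hO hs (ih hμ') i hx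

theorem exists_section_of_solvesAt [IsManifold 𝓘(ℝ, Fin n → ℝ) ∞ M]
    [IsManifold 𝓘(ℝ, (Fin n → ℝ) × (Fin N → ℝ)) ∞ Φ]
    (𝓛 : LagrangianDensity n N π (k + 1)) (hO : IsOpen O)
    (hs : O ⊆ c.base.source) {σ : M → Jets n N k × Mom n N k} (hσ : c.SmoothIn O σ)
    (hd : ∀ x ∈ O, (σ x).1 ∈ c.jetDom k x) (hD : ∀ x ∈ O, SolvesAt 𝓛 c σ x) :
    ∃ s : M → Φ, IsSectionOn n N π O s ∧ Set.MapsTo s O c.tot.source ∧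
      ∀ x ∈ O, (σ x).1 = c.prolong k s x := by
  have h1 : c.SmoothIn O fun y => (σ y).1 := hσ.clm (ContinuousLinearMap.fst ℝ _ _)
  obtain ⟨s, h2, h3, h4⟩ := exists_section hs (h1.apply MIdx.zero) hd
  refine ⟨s, h2, h3, fun x hx => funext fun μ => funext fun K => ?_⟩
  rw [eq_pdMulti_of_solvesAt 𝓛 hO hs hσ hd hD K μ.1 μ.2 x hx]
  exact (pdMulti_congr hO hs (fun y hy => congrFun (h4 y hy) K) μ.1 hx).symm

end Equation

/-! ### Algebra of symmetric momenta. -/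

section SymmetricMomenta

variable {n N k : ℕ}

/-- For `ν + e_i = μ` the weight is `μ_i/|μ|`. Each `i` with `μ_i ≠ 0` admits exactly one `ν`, the
others none, and the weights sum to `1`. -/
theorem symPart_eq_of_forall {p : Mom n N k} {μ : MIdx n (k + 1)} (hμ : 1 ≤ ∑ i, μ.1 i)
    {K : Fin N} {r : ℝ} (h : ∀ (ν : MIdx n k) (i : Fin n), ν.succ i = μ →
      p ν K i = (ν.1 i + 1) / ((∑ j, ν.1 j : ℕ) + 1) * r) : symPart p μ K = r := by
  have key : ∀ i : Fin n, ∑ ν : MIdx n k, (if ν.succ i = μ then p ν K i else 0) =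
      μ.1 i * (r / (∑ j, μ.1 j : ℕ)) := by
    intro i
    by_cases hi : μ.1 i = 0
    · rw [hi, Nat.cast_zero, zero_mul]
      refine Finset.sum_eq_zero fun ν _ => if_neg fun e => ?_
      rw [← e] at hi
      simp [MIdx.succ] at hi
    · obtain ⟨ν, rfl⟩ := μ.exists_succ_eq i hi
      rw [Finset.sum_eq_single ν]
      · have e1 : (ν.succ i).1 i = ν.1 i + 1 := by simp [MIdx.succ]
        have e2 : ∑ j, (ν.succ i).1 j = ∑ j, ν.1 j + 1 := sum_add_single ν.1 i
        rw [if_pos rfl, h ν i rfl, e1, e2]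
        push_cast
        ring
      · intro ν' _ hν'
        exact if_neg fun e => hν' (MIdx.succ_left_injective i e)
      · simp
  have hne : ((∑ i, μ.1 i : ℕ) : ℝ) ≠ 0 := Nat.cast_ne_zero.2 (by omega)
  rw [symPart, Finset.sum_comm]
  simp only [key]
  rw [← Finset.sum_mul, ← Nat.cast_sum, mul_div_cancel₀ _ hne]

theorem prod_factorial_succ {l : ℕ} (ν : MIdx n l) (i : Fin n) :
    ∏ m, ((ν.succ i).1 m).factorial = (ν.1 i + 1) * ∏ m, (ν.1 m).factorial := by
  rw [← Finset.mul_prod_erase _ _ (Finset.mem_univ i),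
    ← Finset.mul_prod_erase _ (fun m => (ν.1 m).factorial) (Finset.mem_univ i), ← mul_assoc]
  have e1 : (ν.succ i).1 i = ν.1 i + 1 := by simp [MIdx.succ]
  rw [e1, Nat.factorial_succ]
  congr 1
  refine Finset.prod_congr rfl fun m hm => ?_
  simp [MIdx.succ, Finset.ne_of_mem_erase hm]

theorem prod_factorial_ne_zero (ν : Fin n → ℕ) :
    ((∏ m, (ν m).factorial : ℕ) : ℝ) ≠ 0 :=
  Nat.cast_ne_zero.2 (Finset.prod_ne_zero_iff.2 fun m _ => (ν m).factorial_ne_zero)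

/-- With `μ = ν + e_i`, `ν! (ν_i + 1)/(|ν| + 1) = μ!/|μ|` depends on `μ` alone. -/
theorem isSymmetric_of_forall {p : Mom n N k} (R : MIdx n (k + 1) → Fin N → ℝ)
    (h : ∀ (ν : MIdx n k) (i : Fin n) (K : Fin N),
      p ν K i = (ν.1 i + 1) / ((∑ j, ν.1 j : ℕ) + 1) * R (ν.succ i) K) : IsSymmetric p := by
  have key : ∀ (ν : MIdx n k) (i : Fin n) (K : Fin N), (∏ m, (ν.1 m).factorial : ℕ) * p ν K i =
      (∏ m, ((ν.succ i).1 m).factorial : ℕ) / (∑ j, (ν.succ i).1 j : ℕ) * R (ν.succ i) K := by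
    intro ν i K
    have e2 : ∑ j, (ν.succ i).1 j = ∑ j, ν.1 j + 1 := sum_add_single ν.1 i
    rw [h, prod_factorial_succ, e2]
    push_cast
    ring
  intro ν ν' i i' e K
  rw [key, key, e]

/-- Symmetric momenta are recovered from their symmetric parts. The common value `C` of `ν! p^{ν i}`
puts all components over `μ` in the weighted form with `r = |μ| C/μ!`, and `symPart_eq_of_forall`
identifies `r`. -/
theorem IsSymmetric.eq_symPart {p : Mom n N k} (hp : IsSymmetric p) (ν : MIdx n k) (i : Fin n)
    (K : Fin N) :
    p ν K i = (ν.1 i + 1) / ((∑ j, ν.1 j : ℕ) + 1) * symPart p (ν.succ i) K := by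
  have hsum : ∀ (ν : MIdx n k) (i : Fin n), ∑ j, (ν.succ i).1 j = ∑ j, ν.1 j + 1 :=
    fun ν i => sum_add_single ν.1 i
  have key : ∀ (ν' : MIdx n k) (i' : Fin n), ν'.succ i' = ν.succ i → p ν' K i' =
      (ν'.1 i' + 1) / ((∑ j, ν'.1 j : ℕ) + 1) * ((∑ j, ν.1 j + 1 : ℕ) /
        (∏ m, ((ν.succ i).1 m).factorial : ℕ) * ((∏ m, (ν.1 m).factorial : ℕ) * p ν K i)) := by
    intro ν' i' e
    have h1 : ∑ j, ν'.1 j + 1 = ∑ j, ν.1 j + 1 := by rw [← hsum ν' i', e, hsum]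
    rw [← hp ν' ν i' i e K, ← e, ← h1, prod_factorial_succ]
    have h2 := prod_factorial_ne_zero ν'.1
    have h3 : ((∑ j, ν'.1 j : ℕ) : ℝ) + 1 ≠ 0 := by positivity
    have h4 : (ν'.1 i' : ℝ) + 1 ≠ 0 := by positivity
    rw [Nat.cast_mul, Nat.cast_add_one, Nat.cast_add_one]
    field_simp
  rw [symPart_eq_of_forall (by rw [hsum]; omega) key]
  exact key ν i rfl

end SymmetricMomenta

/-! ### Solving the momentum equations by recursion on the order. -/

section SymmetricSolutions

variable {n N k : ℕ} {M Φ : Type*} [TopologicalSpace M] [ChartedSpace (Fin n → ℝ) M]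
  [TopologicalSpace Φ] [ChartedSpace ((Fin n → ℝ) × (Fin N → ℝ)) Φ] {π : Φ → M}
  {c : FibredChart n N π} {O : Set M}

open FibredChart

variable (c) in
/-- The solution of `P_μ = f_μ - ∑ ∂_i ((μ_i + 1) / (|μ| + 1) P_{μ + e_i})`, started with
`P_μ = f_μ` after `d` steps. -/
def symMomentum (f : (Fin n → ℕ) → M → ℝ) : ℕ → (Fin n → ℕ) → M → ℝ
  | 0, μ => f μ
  | d + 1, μ => fun x => f μ x - ∑ i, c.pd i (fun y =>
      ((μ i : ℝ) + 1) / ((∑ j, μ j : ℕ) + 1) * symMomentum f d (μ + Pi.single i 1) y) x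

theorem smoothIn_symMomentum (hO : IsOpen O) {f : (Fin n → ℕ) → M → ℝ}
    (hf : ∀ μ, c.SmoothIn O (f μ)) (d : ℕ) (μ : Fin n → ℕ) :
    c.SmoothIn O (symMomentum c f d μ) := by
  induction d generalizing μ with
  | zero => exact hf μ
  | succ d ih => exact (hf μ).sub (SmoothIn.sum fun i _ => ((ih _).const_mul _).pd hO i)

/-- Any smooth functions `f_μ`, `1 ≤ |μ| ≤ k + 1`, are of the form `p^{(μ)} + ∂_i p^{μ i}` with
symmetric momenta. -/
theorem exists_symmetric_momenta (hO : IsOpen O) (hs : O ⊆ c.base.source)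
    {f : MIdx n (k + 1) → Fin N → M → ℝ} (hf : ∀ μ K, c.SmoothIn O (f μ K)) :
    ∃ ρ : M → Mom n N k, c.SmoothIn O ρ ∧ (∀ x, IsSymmetric (ρ x)) ∧
      ∀ x ∈ O, ∀ μ : MIdx n (k + 1), 1 ≤ ∑ i, μ.1 i → ∀ K,
        symPart (ρ x) μ K = f μ K x - divPart (fun i => c.pd i ρ x) μ K := by
  -- Extension by `0` makes the recursion total. Started at `μ` with depth `k + 1 - |μ|`, it never
  -- goes beyond length `k + 1`, so the default is not used.
  let g : Fin N → (Fin n → ℕ) → M → ℝ := fun K μ =>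
    if h : ∑ i, μ i ≤ k + 1 then f ⟨μ, h⟩ K else fun _ => 0
  have hg : ∀ K μ, c.SmoothIn O (g K μ) := by
    intro K μ
    by_cases h : ∑ i, μ i ≤ k + 1
    · simp only [g, h, dite_true]; exact hf _ K
    · simp only [g, h, dite_false]; exact smoothIn_const 0
  have hgf : ∀ K (μ : MIdx n (k + 1)), g K μ.1 = f μ K := fun K μ => by
    simp only [g, dif_pos μ.2]
  let ρ : M → Mom n N k := fun x ν K i => ((ν.1 i : ℝ) + 1) / ((∑ j, ν.1 j : ℕ) + 1) *
    -- The depth is `k + 1 - |ν + e_i|`, the distance to the top order.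
    symMomentum c (g K) (k - ∑ j, ν.1 j) (ν.1 + Pi.single i 1) x
  have hρ : c.SmoothIn O ρ := smoothIn_pi.2 fun ν => smoothIn_pi.2 fun K => smoothIn_pi.2 fun i =>
    (smoothIn_symMomentum hO (hg K) _ _).const_mul _
  have hR : ∀ x (ν : MIdx n k) (i : Fin n) (K : Fin N), ρ x ν K i =
      (ν.1 i + 1) / ((∑ j, ν.1 j : ℕ) + 1) *
        symMomentum c (g K) (k + 1 - ∑ j, (ν.succ i).1 j) (ν.succ i).1 x := by
    intro x ν i K
    have e2 : ∑ j, (ν.succ i).1 j = ∑ j, ν.1 j + 1 := sum_add_single ν.1 i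
    rw [e2, Nat.add_sub_add_right]
    rfl
  refine ⟨ρ, hρ, fun x => isSymmetric_of_forall
    (fun μ K => symMomentum c (g K) (k + 1 - ∑ j, μ.1 j) μ.1 x) (hR x), fun x hx μ hμ K => ?_⟩
  rw [symPart_eq_of_forall hμ fun ν i e => by rw [hR, e], divPart_pd hO hs hρ μ K hx]
  by_cases h : ∑ i, μ.1 i ≤ k
  -- Below the top order the depth is a successor, and one unfolding of `symMomentum` is the
  -- required equation.
  · rw [Nat.succ_sub h, dif_pos h, ← hgf]
    rfl
  · have : k + 1 - ∑ j, μ.1 j = 0 := by omega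
    rw [this, dif_neg h, sub_zero, ← hgf]
    rfl

theorem symmetric_momenta_unique (hO : IsOpen O) (hs : O ⊆ c.base.source)
    {f : MIdx n (k + 1) → Fin N → M → ℝ} {ρ ρ' : M → Mom n N k} (hρ : c.SmoothIn O ρ)
    (hρ' : c.SmoothIn O ρ') (hsymm : ∀ x ∈ O, IsSymmetric (ρ x))
    (hsymm' : ∀ x ∈ O, IsSymmetric (ρ' x))
    (h : ∀ x ∈ O, ∀ μ K, symPart (ρ x) μ K = f μ K x - divPart (fun i => c.pd i ρ x) μ K)
    (h' : ∀ x ∈ O, ∀ μ K, symPart (ρ' x) μ K = f μ K x - divPart (fun i => c.pd i ρ' x) μ K) :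
    Set.EqOn ρ ρ' O := by
  -- Descending induction on `|ν|`: by `IsSymmetric.eq_symPart` and the equation at `ν + e_i`, `p^{ν
  -- i}` is determined by `f` and derivatives of momenta of length `|ν| + 1`. At `|ν| = k` no
  -- divergence remains.
  have key : ∀ (d : ℕ) (ν : MIdx n k), k ≤ ∑ j, ν.1 j + d → ∀ K i, ∀ x ∈ O,
      ρ x ν K i = ρ' x ν K i := by
    intro d
    induction d with
    | zero =>
      intro ν hν K i x hx
      have hn : ¬ ∑ j, (ν.succ i).1 j ≤ k := by
        have e2 : ∑ j, (ν.succ i).1 j = ∑ j, ν.1 j + 1 := sum_add_single ν.1 i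
        omega
      rw [(hsymm x hx).eq_symPart, (hsymm' x hx).eq_symPart, h x hx, h' x hx,
        divPart_pd hO hs hρ _ K hx, divPart_pd hO hs hρ' _ K hx, dif_neg hn, dif_neg hn]
    | succ d ih =>
      intro ν hν K i x hx
      have e2 : ∑ j, (ν.succ i).1 j = ∑ j, ν.1 j + 1 := sum_add_single ν.1 i
      rw [(hsymm x hx).eq_symPart, (hsymm' x hx).eq_symPart, h x hx, h' x hx,
        divPart_pd hO hs hρ _ K hx, divPart_pd hO hs hρ' _ K hx]
      congr 2
      refine dite_congr rfl (fun hk => Finset.sum_congr rfl fun j _ => ?_) fun _ => rfl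
      exact pd_congr hO hs (fun y hy => ih ⟨_, hk⟩ (by simp only [e2]; omega) K j y hy) j hx
  intro x hx
  funext ν K i
  exact key k ν (by omega) K i x hx

end SymmetricSolutions

end HOVar

end

/-! ### The three assertions assembled. -/

theorem mainTheorem3 {n N k : ℕ} [NeZero n] {M Φ : Type*}
    [TopologicalSpace M] [ChartedSpace (Fin n → ℝ) M] [IsManifold 𝓘(ℝ, Fin n → ℝ) ∞ M]
    [TopologicalSpace Φ] [ChartedSpace ((Fin n → ℝ) × (Fin N → ℝ)) Φ]
    [IsManifold 𝓘(ℝ, (Fin n → ℝ) × (Fin N → ℝ)) ∞ Φ]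
    (π : Φ → M) (hπ : HOVar.IsFibred n N π)
    (𝓛 : HOVar.LagrangianDensity n N π (k + 1)) (c : HOVar.FibredChart n N π) :
    -- `𝓓_x` is the image of a smooth section, it is the only one satisfying the generating formula,
    -- and it is Lagrangian
    (∀ x ∈ c.base.source,
      HOVar.IsSmoothSectionImage (HOVar.dynamics 𝓛 c x) ∧
      (∀ S, HOVar.IsSmoothSectionImage S →
        (HOVar.GeneratingFormula 𝓛 c x S ↔ S = HOVar.dynamics 𝓛 c x)) ∧
      HOVar.IsLagrangian HOVar.omegaI (HOVar.coordImage (HOVar.dynamics 𝓛 c x))) ∧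
    -- `𝓓` as a first-order equation for sections of the phase bundle
    (∀ O : Set M, IsOpen O → O ⊆ c.base.source →
      ∀ σ : M → HOVar.Jets n N k × HOVar.Mom n N k, HOVar.IsPhaseSection c O σ →
        ((∀ x ∈ O, HOVar.SolvesAt 𝓛 c σ x) ↔
          ∃ s : M → Φ, HOVar.IsSectionOn n N π O s ∧ Set.MapsTo s O c.tot.source ∧
            ∀ x ∈ O, (σ x).1 = c.prolong k s x ∧ ∀ μ, HOVar.MomentumEq 𝓛 c s σ x μ) ∧
        ((∀ x ∈ O, HOVar.SolvesAt 𝓛 c σ x) ↔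
          ∃ s : M → Φ, HOVar.IsSectionOn n N π O s ∧ Set.MapsTo s O c.tot.source ∧
            ∀ x ∈ O, (σ x).1 = c.prolong k s x ∧
              (∀ μ, 1 ≤ ∑ i, μ.1 i → HOVar.MomentumEq 𝓛 c s σ x μ) ∧
              HOVar.EulerLagrangeAt 𝓛 c s x)) ∧
    -- the fields which underlie solutions are the solutions of the Euler–Lagrange equations; with
    -- symmetric momenta the solution is unique
    (∀ O : Set M, IsOpen O → O ⊆ c.base.source →
      ∀ s : M → Φ, HOVar.IsSectionOn n N π O s → Set.MapsTo s O c.tot.source →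
        ((∀ x ∈ O, HOVar.EulerLagrangeAt 𝓛 c s x) ↔
          ∃ σ : M → HOVar.Jets n N k × HOVar.Mom n N k, HOVar.IsPhaseSection c O σ ∧
            ∀ x ∈ O, (σ x).1 = c.prolong k s x ∧ HOVar.SolvesAt 𝓛 c σ x) ∧
        ((∀ x ∈ O, HOVar.EulerLagrangeAt 𝓛 c s x) →
          ∃ σ : M → HOVar.Jets n N k × HOVar.Mom n N k,
            (HOVar.IsPhaseSection c O σ ∧ ∀ x ∈ O, (σ x).1 = c.prolong k s x ∧
              HOVar.SolvesAt 𝓛 c σ x ∧ HOVar.IsSymmetric (σ x).2) ∧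
            ∀ σ' : M → HOVar.Jets n N k × HOVar.Mom n N k,
              (HOVar.IsPhaseSection c O σ' ∧ ∀ x ∈ O, (σ' x).1 = c.prolong k s x ∧
                HOVar.SolvesAt 𝓛 c σ' x ∧ HOVar.IsSymmetric (σ' x).2) →
              ∀ x ∈ O, σ' x = σ x)) := by
  refine ⟨fun x _ => ⟨HOVar.isSmoothSectionImage_dynamics 𝓛 c x,
    HOVar.generatingFormula_iff 𝓛 c x, HOVar.isLagrangian_dynamics 𝓛 c x⟩, ?_, ?_⟩
  · intro O hO hs σ hσ
    have hσ1 := HOVar.FibredChart.smoothIn_of_contMDiffOn (c := c) hσ.1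
    have hσ2 : c.SmoothIn O fun y => (σ y).2 := hσ1.clm (ContinuousLinearMap.snd ℝ _ _)
    have key : (∀ x ∈ O, HOVar.SolvesAt 𝓛 c σ x) ↔
        ∃ s : M → Φ, HOVar.IsSectionOn n N π O s ∧ Set.MapsTo s O c.tot.source ∧
          ∀ x ∈ O, (σ x).1 = c.prolong k s x ∧ ∀ μ, HOVar.MomentumEq 𝓛 c s σ x μ := by
      constructor
      · intro h
        obtain ⟨s, h1, h2, h3⟩ := HOVar.exists_section_of_solvesAt 𝓛 hO hs hσ1 hσ.2 h
        exact ⟨s, h1, h2, fun x hx => ⟨h3 x hx, (HOVar.solvesAt_iff_momentumEq 𝓛 hO hs hσ1 hσ.2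
          (HOVar.FibredChart.smoothIn_section h1 h2) h3 hx).1 (h x hx)⟩⟩
      · rintro ⟨s, h1, h2, h3⟩ x hx
        exact (HOVar.solvesAt_iff_momentumEq 𝓛 hO hs hσ1 hσ.2
          (HOVar.FibredChart.smoothIn_section h1 h2) (fun y hy => (h3 y hy).1) hx).2 (h3 x hx).2
    refine ⟨key, key.trans (exists_congr fun s => and_congr_right fun _ =>
      and_congr_right fun _ => ?_)⟩
    rw [forall₂_and, forall₂_and, HOVar.momentumEq_iff_eulerLagrange 𝓛 hO hs hσ2]
  · intro O hO hs s h1 h2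
    have hsm := HOVar.FibredChart.smoothIn_section h1 h2
    have hp := HOVar.FibredChart.smoothIn_prolong hO hsm k
    have ht := fun x (hx : x ∈ O) => HOVar.FibredChart.tot_section h1 h2 hx
    have hex : (∀ x ∈ O, HOVar.EulerLagrangeAt 𝓛 c s x) →
        ∃ σ : M → HOVar.Jets n N k × HOVar.Mom n N k, HOVar.IsPhaseSection c O σ ∧
          ∀ x ∈ O, (σ x).1 = c.prolong k s x ∧ HOVar.SolvesAt 𝓛 c σ x ∧
            HOVar.IsSymmetric (σ x).2 := by
      intro hEL
      obtain ⟨ρ, hρ, hsymm, hmom⟩ := HOVar.exists_symmetric_momenta (k := k) hO hs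
        (f := fun μ K y => 𝓛.dL c y (c.prolong (k + 1) s y) μ K)
        (fun μ K => 𝓛.smoothIn_dL hO hsm ht μ K)
      have hσ : c.SmoothIn O fun x => (c.prolong k s x, ρ x) := hp.prodMk hρ
      have hd : ∀ x ∈ O, c.prolong k s x ∈ c.jetDom k x := fun x hx => by
        have := ht x hx
        rwa [← HOVar.FibredChart.prolong_apply_zero k s x] at this
      -- The recursion supplies the equations with `|μ| ≥ 1`; the Euler–Lagrange equations supply
      -- the remaining one, `μ = 0`.
      have hM := (HOVar.momentumEq_iff_eulerLagrange 𝓛 hO hs (s := s)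
        (σ := fun x => (c.prolong k s x, ρ x)) hρ).2
        fun x hx => ⟨fun μ hμ => hmom x hx μ hμ, hEL x hx⟩
      exact ⟨fun x => (c.prolong k s x, ρ x), ⟨hσ.contMDiffOn hs, hd⟩, fun x hx => ⟨rfl,
        (HOVar.solvesAt_iff_momentumEq 𝓛 hO hs hσ hd hsm (fun _ _ => rfl) hx).2 (hM x hx),
        hsymm x⟩⟩
    have hmom : ∀ σ : M → HOVar.Jets n N k × HOVar.Mom n N k, HOVar.IsPhaseSection c O σ →
        (∀ x ∈ O, (σ x).1 = c.prolong k s x ∧ HOVar.SolvesAt 𝓛 c σ x) →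
        c.SmoothIn O (fun y => (σ y).2) ∧ ∀ x ∈ O, ∀ μ, HOVar.MomentumEq 𝓛 c s σ x μ := by
      intro σ hσ h
      have hσ1 := HOVar.FibredChart.smoothIn_of_contMDiffOn (c := c) hσ.1
      exact ⟨hσ1.clm (ContinuousLinearMap.snd ℝ _ _), fun x hx =>
        (HOVar.solvesAt_iff_momentumEq 𝓛 hO hs hσ1 hσ.2 hsm (fun y hy => (h y hy).1) hx).1
          (h x hx).2⟩
    refine ⟨⟨fun hEL => ?_, ?_⟩, fun hEL => ?_⟩
    · obtain ⟨σ, hσ, h⟩ := hex hEL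
      exact ⟨σ, hσ, fun x hx => ⟨(h x hx).1, (h x hx).2.1⟩⟩
    · rintro ⟨σ, hσ, h⟩ x hx
      obtain ⟨h3, h4⟩ := hmom σ hσ h
      exact ((HOVar.momentumEq_iff_eulerLagrange 𝓛 hO hs h3).1 h4 x hx).2
    · obtain ⟨σ, hσ, h⟩ := hex hEL
      refine ⟨σ, ⟨hσ, h⟩, fun σ' ⟨hσ', h'⟩ x hx => Prod.ext ?_ ?_⟩
      · rw [(h' x hx).1, (h x hx).1]
      · obtain ⟨h3, h4⟩ := hmom σ hσ fun y hy => ⟨(h y hy).1, (h y hy).2.1⟩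
        obtain ⟨h5, h6⟩ := hmom σ' hσ' fun y hy => ⟨(h' y hy).1, (h' y hy).2.1⟩
        -- Both solutions lie over the same `s`, so their momenta satisfy the recursion with the
        -- same source `∂L/∂φ_μ`.
        exact HOVar.symmetric_momenta_unique hO hs h5 h3 (fun y hy => (h' y hy).2.2)
          (fun y hy => (h y hy).2.2)
          (f := fun μ K y => 𝓛.dL c y (c.prolong (k + 1) s y) μ K) h6 h4 hx
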